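/- Let $k$ be a field, $S=k[y_1,y_2,y_3]$ with the standard grading, $f=y_1^3+y_1^2y_3-y_2^2y_3$ and $R=S/(f)$. Let $V(f)\subset\mathbb P^2(k)$ be the set of $k$-rational points of the curve $f=0$, let $s=(0:0:1)$ be its unique singular point, $\lambda_0=(0:1:0)$, and let $V(f)_{\mathrm{reg}}=V(f)\setminus\{s\}$ be the set of regular points. For $\lambda=(\lambda_1:\lambda_2:1)\in V(f)$ put \[ \alpha_\lambda=\begin{pmatrix} 0 & y_1-\lambda_1y_3 & y_2-\lambda_2y_3\\ y_1 & y_2+\lambda_2y_3 & (\lambda_1^2+\lambda_1)y_3\\ y_3 & 0 & -y_1-(\lambda_1+1)y_3 \end{pmatrix}, \] let $\beta_\lambda$ be the adjugate matrix of $\alpha_\lambda$, and let $\operatorname{Coker}\alpha_\lambda$ be the cokernel of the graded map $\alpha_\lambda:R(-2)^3\to R(-1)^3$ (acting on column vectors), with the induced $\mathbb Z$-grading. A graded maximal Cohen--Macaulay (MCM) $R$-module is a finitely generated $\mathbb Z$-graded $R$-module whose depth with respect to $(y_1,y_2,y_3)$ equals $\dim R$; a module is called three-generated if its minimal number of generators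 is $3$; the rank is the rank over the domain $R$. Then for every $\lambda=(\lambda_1:\lambda_2:1)\in V(f)$ the pair $(\alpha_\lambda,\beta_\lambda)$ is a graded matrix factorization of $f$, that is, both matrices have homogeneous entries and $\alpha_\lambda\beta_\lambda=\beta_\lambda\alpha_\lambda=f\cdot\mathbf 1_3$. For every $\lambda\in V(f)_{\mathrm{reg}}\setminus\{\lambda_0\}$ the module $\operatorname{Coker}\alpha_\lambda$ is a three-generated graded MCM $R$-module, and: (1) $\operatorname{Coker}\alpha_\lambda$ has rank $1$ for every $\lambda\in V(f)_{\mathrm{reg}}\setminus\{\lambda_0\}$. (2) For $\lambda\neq\xi$ in $V(f)_{\mathrm{reg}}\setminus\{\lambda_0\}$ the $R$-modules $\operatorname{Coker}\alpha_\lambda$ and $\operatorname{Coker}\alpha_\xi$ are not isomorphic. (3) Every three-generated graded MCM $R$-module of rank $1$ is isomorphic, as a graded module and up to a shift of the grading, to $\operatorname{Coker}\alpha_\lambda$ for some $\lambda\in V(f)_{\mathrm{reg}}\setminus\{\lambda_0\}$ or to $\operatorname{Coker}\alpha_s$. -/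

import Mathlib

noncomputable section

namespace NodalCone

open MvPolynomial

universe u v

/-- The cubic `f = y₁³ + y₁² y₃ - y₂² y₃` in `S = k[y₁, y₂, y₃]`, with `y₁, y₂, y₃` written
`X 0, X 1, X 2`. -/
def cubic (k : Type u) [Field k] : MvPolynomial (Fin 3) k :=
  X 0 ^ 3 + X 0 ^ 2 * X 2 - X 1 ^ 2 * X 2

/-- The hypersurface ring `R = S / (f)`. -/
abbrev NodeRing (k : Type u) [Field k] : Type u :=
  MvPolynomial (Fin 3) k ⧸ Ideal.span {cubic k}

/-- The quotient map `S → R`. -/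
abbrev quot (k : Type u) [Field k] : MvPolynomial (Fin 3) k →+* NodeRing k :=
  Ideal.Quotient.mk (Ideal.span {cubic k})

/-- The homogeneous component `R_n` for `n : ℤ`: the image of the forms of degree `n` if `n ≥ 0`,
and zero if `n < 0`. -/
def ringDeg (k : Type u) [Field k] : ℤ → AddSubgroup (NodeRing k)
  | Int.ofNat n =>
      (homogeneousSubmodule (Fin 3) k n).toAddSubgroup.map (quot k).toAddMonoidHom
  | Int.negSucc _ => ⊥

/-- The irrelevant maximal ideal `(y₁, y₂, y₃)` of `R`. -/
def irrelevant (k : Type u) [Field k] : Ideal (NodeRing k) :=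
  Ideal.span (Set.range fun i : Fin 3 => quot k (X i))

/-- `𝓜` is a `ℤ`-grading of the `R`-module `M`. -/
def IsGraded {k : Type u} [Field k] {M : Type v} [AddCommGroup M] [Module (NodeRing k) M]
    (𝓜 : ℤ → AddSubgroup M) : Prop :=
  DirectSum.IsInternal 𝓜 ∧
    ∀ (i j : ℤ) (r : NodeRing k) (m : M), r ∈ ringDeg k i → m ∈ 𝓜 j → r • m ∈ 𝓜 (i + j)

/-- `M`, with the grading `𝓜`, is a graded maximal Cohen–Macaulay `R`-module: finitely generated,
graded, and of depth `dim R`, that is, there is an `M`-regular sequence of length `dim R` in the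
irrelevant ideal. -/
def IsGradedMCM {k : Type u} [Field k] {M : Type v} [AddCommGroup M] [Module (NodeRing k) M]
    (𝓜 : ℤ → AddSubgroup M) : Prop :=
  Module.Finite (NodeRing k) M ∧ IsGraded (k := k) 𝓜 ∧
    ∃ rs : List (NodeRing k), (∀ r ∈ rs, r ∈ irrelevant k) ∧
      (rs.length : WithBot ℕ∞) = ringKrullDim (NodeRing k) ∧ RingTheory.Sequence.IsRegular M rs

/-- The minimal number of generators of `M` is `n`. -/
def IsMinimallyGenerated (k : Type u) [Field k] (M : Type v) [AddCommGroup M] [Module (NodeRing k) M]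
    (n : ℕ) : Prop :=
  (⊤ : Submodule (NodeRing k) M).spanRank = n

/-- `(A, B)` is a (graded) matrix factorization of `f`: the entries are homogeneous and
`A B = B A = f · 1`. -/
def IsMatrixFactorization {k : Type u} [Field k] {n : ℕ} (f : MvPolynomial (Fin 3) k)
    (A B : Matrix (Fin n) (Fin n) (MvPolynomial (Fin 3) k)) : Prop :=
  (∀ i j, ∃ d : ℕ, (A i j).IsHomogeneous d) ∧ (∀ i j, ∃ d : ℕ, (B i j).IsHomogeneous d) ∧
    A * B = f • (1 : Matrix (Fin n) (Fin n) (MvPolynomial (Fin 3) k)) ∧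
    B * A = f • (1 : Matrix (Fin n) (Fin n) (MvPolynomial (Fin 3) k))

/-- The cokernel of the map `R³ → R³` given by multiplication of column vectors by `A`. -/
abbrev Coker {k : Type u} [Field k]
    (A : Matrix (Fin 3) (Fin 3) (MvPolynomial (Fin 3) k)) : Type u :=
  (Fin 3 → NodeRing k) ⧸ LinearMap.range (Matrix.mulVecLin (A.map (quot k)))

/-- The grading on `Coker A` induced from the target of `A : R(-2)³ → R(-1)³`: the component of
degree `j` is the image of the vectors with all entries in `R(-1)_j = R_{j-1}`. -/
def cokerDeg {k : Type u} [Field k] (A : Matrix (Fin 3) (Fin 3) (MvPolynomial (Fin 3) k))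
    (j : ℤ) : AddSubgroup (Coker A) :=
  (AddSubgroup.pi Set.univ fun _ : Fin 3 => ringDeg k (j - 1)).map
    (LinearMap.range (Matrix.mulVecLin (A.map (quot k)))).mkQ.toAddMonoidHom

/-- Two graded modules are isomorphic up to a shift of the grading. -/
def IsoUpToShift {k : Type u} [Field k] {M : Type v} [AddCommGroup M] [Module (NodeRing k) M]
    {N : Type u} [AddCommGroup N] [Module (NodeRing k) N]
    (𝓜 : ℤ → AddSubgroup M) (𝓝 : ℤ → AddSubgroup N) : Prop :=
  ∃ (n : ℤ) (e : M ≃ₗ[NodeRing k] N), ∀ (j : ℤ) (m : M), m ∈ 𝓜 j ↔ e m ∈ 𝓝 (j + n)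

/-- The curve `V(f)` as a set of points of `ℙ²(k)`; as `f` is homogeneous, the choice of
representative does not matter. -/
def curve (k : Type u) [Field k] : Set (Projectivization k (Fin 3 → k)) :=
  {P | eval P.rep (cubic k) = 0}

/-- The point `(a : b : 1)`. -/
def pt {k : Type u} [Field k] (a b : k) : Projectivization k (Fin 3 → k) :=
  Projectivization.mk k ![a, b, 1] fun h => one_ne_zero (congrFun h 2)

/-- The point `λ₀ = (0 : 1 : 0)`. -/
def pt₀ (k : Type u) [Field k] : Projectivization k (Fin 3 → k) :=
  Projectivization.mk k ![0, 1, 0] fun h => one_ne_zero (congrFun h 1)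

/-- The set of regular points of the curve: those at which some partial derivative of `f` does not
vanish. -/
def regularLocus (k : Type u) [Field k] : Set (Projectivization k (Fin 3 → k)) :=
  {P | P ∈ curve k ∧ ∃ i, eval P.rep (pderiv i (cubic k)) ≠ 0}

/-- The matrix `α_λ` for `λ = (a : b : 1)`. -/
def alpha {k : Type u} [Field k] (a b : k) :
    Matrix (Fin 3) (Fin 3) (MvPolynomial (Fin 3) k) :=
  !![0, X 0 - C a * X 2, X 1 - C b * X 2;
     X 0, X 1 + C b * X 2, C (a ^ 2 + a) * X 2;
     X 2, 0, -X 0 - C (a + 1) * X 2]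

/-- The matrix `β_λ`, the adjoint (adjugate) of `α_λ`. -/
def beta {k : Type u} [Field k] (a b : k) :
    Matrix (Fin 3) (Fin 3) (MvPolynomial (Fin 3) k) :=
  (alpha a b).adjugate

end NodalCone

end

open NodalCone

/-!
The ring `R` is free over `A = k[y₂, y₃]` with basis `1, y₁, y₁²`. Since `(α, β)` is a matrix
factorization, the cokernel of `α` is isomorphic to the kernel of `α` in `R³`. So it has depth two,
and the last coordinate embeds it in `R`, which makes it torsion-free of rank one.

Conversely, a graded maximal Cohen–Macaulay module is free over `A` on a homogeneous basis, which
has three elements if the module has rank one. If the module is also three-generated, the basis is a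
minimal system of generators over `R`; then `y₁` maps no basis element to a combination involving
one of larger degree, and as `1, y₁, y₁²` are independent over `A`, all degrees agree. So `y₁` acts
by a pencil `Φ = y₂ P + y₃ Q` of `3 × 3` matrices over `k` with `Φ³ + y₃ Φ² = y₂² y₃`. Here `P` is
conjugate to a nilpotent Jordan block, and conjugations that fix it bring `Q` to a normal form with
two parameters that satisfy `b² = a³ + a²`. The relations `y₁ mⱼ = ∑ᵢ Φᵢⱼ mᵢ` are then, up to sign
and order of the generators, the columns of `α`.
-/

noncomputable section

namespace NodalCone

open MvPolynomial

universe u v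

section WeaklyRegular

open RingTheory.Sequence

variable {R : Type*} [CommRing R]

theorem isWeaklyRegular_pair_iff {M : Type*} [AddCommGroup M] [Module R M] (r s : R) :
    IsWeaklyRegular M [r, s] ↔
      IsSMulRegular M r ∧ ∀ m m' : M, s • m = r • m' → ∃ m'' : M, m = r • m'' := by
  rw [isWeaklyRegular_cons_iff, isWeaklyRegular_singleton_iff,
    isSMulRegular_quotient_iff_mem_of_smul_mem]
  simp only [Submodule.mem_smul_pointwise_iff_exists, Submodule.mem_top, true_and]
  refine and_congr_right fun _ => ⟨fun h m m' hm => ?_, fun h m ⟨m', hm⟩ => ?_⟩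
  · obtain ⟨x, hx⟩ := h m ⟨m', hm.symm⟩
    exact ⟨x, hx.symm⟩
  · obtain ⟨x, hx⟩ := h m m' hm.symm
    exact ⟨x, hx.symm⟩

theorem isWeaklyRegular_pair_of_prime [IsDomain R] {p s : R} (hp : Prime p) (hs : ¬ p ∣ s) :
    IsWeaklyRegular R [p, s] :=
  (isWeaklyRegular_pair_iff p s).2 ⟨IsSMulRegular.of_ne_zero hp.ne_zero, fun _ _ h =>
    (hp.dvd_or_dvd (Dvd.intro _ h.symm)).resolve_left hs⟩

theorem isWeaklyRegular_pair_pi {ι M : Type*} [AddCommGroup M] [Module R M] {r s : R}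
    (h : IsWeaklyRegular M [r, s]) : IsWeaklyRegular (ι → M) [r, s] := by
  rw [isWeaklyRegular_pair_iff] at h ⊢
  refine ⟨.pi fun _ => h.1, fun m m' hm => ?_⟩
  choose m'' hm'' using fun i => h.2 (m i) (m' i) (congrFun hm i)
  exact ⟨m'', funext hm''⟩

theorem isWeaklyRegular_pair_ker {M N : Type*} [AddCommGroup M] [Module R M] [AddCommGroup N]
    [Module R N] (φ : M →ₗ[R] N) {r s : R} (hM : IsWeaklyRegular M [r, s])
    (hN : IsSMulRegular N r) : IsWeaklyRegular (LinearMap.ker φ) [r, s] := by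
  rw [isWeaklyRegular_pair_iff] at hM ⊢
  refine ⟨hM.1.submodule _ _, fun m m' hm => ?_⟩
  obtain ⟨x, hx⟩ := hM.2 m m' (congrArg Subtype.val hm)
  have hφ : r • φ x = 0 := by rw [← map_smul, ← hx, LinearMap.map_coe_ker]
  exact ⟨⟨x, hN.right_eq_zero_of_smul hφ⟩, Subtype.ext hx⟩

end WeaklyRegular

section MatrixFactorization

variable {S n : Type*} [CommRing S] [Fintype n] [DecidableEq n] {f : S} {A B : Matrix n n S}

open Ideal.Quotient in
theorem range_mulVecLin_eq_ker_of_mul_eq_smul_one (hf : f ∈ nonZeroDivisors S)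
    (hAB : A * B = f • (1 : Matrix n n S)) (hBA : B * A = f • (1 : Matrix n n S)) :
    LinearMap.range (A.map (mk (Ideal.span {f}))).mulVecLin =
      LinearMap.ker (B.map (mk (Ideal.span {f}))).mulVecLin := by
  apply le_antisymm
  · rintro _ ⟨x, rfl⟩
    have hzero : B.map (mk (Ideal.span {f})) * A.map (mk (Ideal.span {f})) = 0 := by
      rw [← Matrix.map_mul, hBA]
      ext i j
      simp [Matrix.one_apply, apply_ite]
    simp [Matrix.mulVec_mulVec, hzero]
  · intro x hx
    obtain ⟨y, rfl⟩ : ∃ y : n → S, mk (Ideal.span {f}) ∘ y = x :=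
      mk_surjective.comp_left x
    have hdvd (i : n) : f ∣ (B.mulVec y) i := by
      rw [← Ideal.mem_span_singleton, ← eq_zero_iff_mem, RingHom.map_mulVec]
      exact congrFun hx i
    choose z hz using hdvd
    have hy : y = A.mulVec z := by
      funext i
      refine (mul_cancel_left_mem_nonZeroDivisors hf).1 ?_
      have h := congrArg (fun v => A.mulVec v i) (show B.mulVec y = f • z from funext hz)
      simpa [Matrix.mulVec_mulVec, hAB, Matrix.smul_mulVec, Matrix.mulVec_smul] using h
    refine ⟨mk (Ideal.span {f}) ∘ z, funext fun i => ?_⟩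
    rw [hy, Matrix.mulVecLin_apply, ← RingHom.map_mulVec, Function.comp_apply]

open Ideal.Quotient in
/-- The two-periodicity of the resolution attached to a matrix factorization `(A, B)` of `f`:
multiplication by `B` identifies the cokernel of `A` over `S / (f)` with the kernel of `A`. -/
def cokerEquivKer (hf : f ∈ nonZeroDivisors S) (hAB : A * B = f • (1 : Matrix n n S))
    (hBA : B * A = f • (1 : Matrix n n S)) :
    ((n → S ⧸ Ideal.span {f}) ⧸ LinearMap.range (A.map (mk (Ideal.span {f}))).mulVecLin)
      ≃ₗ[S ⧸ Ideal.span {f}] LinearMap.ker (A.map (mk (Ideal.span {f}))).mulVecLin :=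
  Submodule.quotEquivOfEq _ _ (range_mulVecLin_eq_ker_of_mul_eq_smul_one hf hAB hBA) ≪≫ₗ
    (B.map (mk (Ideal.span {f}))).mulVecLin.quotKerEquivRange ≪≫ₗ
    LinearEquiv.ofEq _ _ (range_mulVecLin_eq_ker_of_mul_eq_smul_one hf hBA hAB)

end MatrixFactorization

section HomogeneousMatrix

variable {σ R : Type*} [CommRing R] {d : ℕ}

theorem isHomogeneous_det {n : Type*} [Fintype n] [DecidableEq n]
    {A : Matrix n n (MvPolynomial σ R)} (hA : ∀ i j, (A i j).IsHomogeneous d) :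
    A.det.IsHomogeneous (Fintype.card n * d) := by
  rw [Matrix.det_apply]
  refine IsHomogeneous.sum _ _ _ fun τ _ => ?_
  have hprod := IsHomogeneous.prod Finset.univ _ _ fun i _ => hA (τ i) i
  rw [Finset.sum_const, Finset.card_univ, smul_eq_mul] at hprod
  rw [Units.smul_def]
  exact (homogeneousSubmodule σ R _).toAddSubgroup.zsmul_mem hprod _

theorem isHomogeneous_adjugate {n : ℕ} {A : Matrix (Fin (n + 1)) (Fin (n + 1)) (MvPolynomial σ R)}
    (hA : ∀ i j, (A i j).IsHomogeneous d) (i j : Fin (n + 1)) :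
    (A.adjugate i j).IsHomogeneous (n * d) := by
  have hdet := isHomogeneous_det (A := A.submatrix j.succAbove i.succAbove) fun _ _ => hA _ _
  rw [Fintype.card_fin] at hdet
  have hsign := (isHomogeneous_C σ ((-1 : R) ^ (j + i : ℕ))).mul hdet
  rw [Matrix.adjugate_fin_succ_eq_det_submatrix]
  simpa using hsign

end HomogeneousMatrix

section IntComponent

variable {σ R : Type*} [CommSemiring R]

/-- The homogeneous component of a polynomial in an integral degree, zero in negative degrees. -/
def intComponent (n : ℤ) : MvPolynomial σ R →ₗ[R] MvPolynomial σ R :=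
  if 0 ≤ n then homogeneousComponent n.toNat else 0

theorem intComponent_of_neg {n : ℤ} (hn : n < 0) (p : MvPolynomial σ R) :
    intComponent n p = 0 := by
  simp [intComponent, not_le.2 hn]

theorem intComponent_natCast (n : ℕ) (p : MvPolynomial σ R) :
    intComponent (n : ℤ) p = homogeneousComponent n p := by
  simp [intComponent]

theorem intComponent_zero (p : MvPolynomial σ R) : intComponent 0 p = C (constantCoeff p) :=
  (intComponent_natCast 0 p).trans (homogeneousComponent_zero p)

theorem intComponent_of_isHomogeneous {m : ℕ} {p : MvPolynomial σ R} (hp : p.IsHomogeneous m)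
    (n : ℤ) : intComponent n p = if n = m then p else 0 := by
  rcases lt_or_ge n 0 with hn | hn
  · rw [intComponent_of_neg hn, if_neg (by omega)]
  · lift n to ℕ using hn
    rw [intComponent_natCast, homogeneousComponent_of_mem hp]
    norm_cast

theorem intComponent_intComponent (m n : ℤ) (p : MvPolynomial σ R) :
    intComponent m (intComponent n p) = if m = n then intComponent n p else 0 := by
  rcases lt_or_ge n 0 with hn | hn
  · simp [intComponent_of_neg hn]
  · lift n to ℕ using hn
    rw [intComponent_natCast,
      intComponent_of_isHomogeneous (homogeneousComponent_isHomogeneous n p)]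

theorem sum_intComponent (p : MvPolynomial σ R) :
    ∑ i ∈ Finset.range (p.totalDegree + 1), intComponent (i : ℤ) p = p := by
  simp_rw [intComponent_natCast]
  exact sum_homogeneousComponent p

theorem intComponent_mul {m : ℕ} {q : MvPolynomial σ R} (hq : q.IsHomogeneous m) (n : ℤ)
    (p : MvPolynomial σ R) : intComponent n (q * p) = q * intComponent (n - m) p := by
  conv_lhs => rw [← sum_intComponent p, Finset.mul_sum, map_sum]
  conv_rhs => rw [← sum_intComponent p, map_sum, Finset.mul_sum]
  refine Finset.sum_congr rfl fun i _ => ?_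
  rw [intComponent_intComponent, intComponent_natCast,
    intComponent_of_isHomogeneous (hq.mul (homogeneousComponent_isHomogeneous i p))]
  by_cases h : n = (m : ℤ) + i
  · rw [if_pos (by push_cast; exact h), if_pos (by omega)]
  · rw [if_neg (by push_cast; exact h), if_neg (by omega), mul_zero]

theorem intComponent_mulVec {m n : Type*} [Fintype n] {d : ℕ} {A : Matrix m n (MvPolynomial σ R)}
    (hA : ∀ i j, (A i j).IsHomogeneous d) (e : ℤ) (w : n → MvPolynomial σ R) :
    intComponent e ∘ A.mulVec w = A.mulVec (intComponent (e - d) ∘ w) := by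
  funext i
  simp only [Matrix.mulVec, dotProduct, Function.comp_apply, map_sum, intComponent_mul (hA i _)]

end IntComponent

section Internal

variable {ι M N : Type*} [DecidableEq ι] [AddCommGroup M] [AddCommGroup N]

theorem isInternal_of_projections (𝓜 : ι → AddSubgroup M) (π : ι → M →+ M)
    (hπ : ∀ i j, ∀ x ∈ 𝓜 j, π i x = if i = j then x else 0) (htop : ⨆ i, 𝓜 i = ⊤) :
    DirectSum.IsInternal 𝓜 := by
  constructor
  · have hcoe (i : ι) (x : DirectSum ι fun j => 𝓜 j) :
        π i (DirectSum.coeAddMonoidHom 𝓜 x) = x i := by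
      induction x using DirectSum.induction_on with
      | zero => simp
      | of j y =>
        rw [DirectSum.coeAddMonoidHom_of, hπ i j y y.2, DirectSum.coe_of_apply]
        rcases eq_or_ne i j with rfl | hij
        · simp
        · simp [hij, hij.symm]
      | add x y hx hy => simp [hx, hy]
    intro x y hxy
    ext i
    rw [← hcoe, hxy, hcoe]
  · rw [← AddMonoidHom.range_eq_top, eq_top_iff, ← htop, iSup_le_iff]
    exact fun i x hx => ⟨DirectSum.of (fun j => 𝓜 j) i ⟨x, hx⟩, DirectSum.coeAddMonoidHom_of _ _ _⟩

theorem isInternal_map_of_projections (π : ι → M →+ M)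
    (hπ : ∀ i j x, π i (π j x) = if i = j then π j x else 0) (htop : ⨆ i, (π i).range = ⊤)
    (φ : M →+ N) (hφ : Function.Surjective φ) (hker : ∀ i x, φ x = 0 → φ (π i x) = 0) :
    DirectSum.IsInternal fun i => (π i).range.map φ := by
  let ψ (i : ι) : N →+ N := φ.liftOfSurjective hφ ⟨φ.comp (π i), hker i⟩
  have hψ (i : ι) (x : M) : ψ i (φ x) = φ (π i x) :=
    φ.liftOfRightInverse_comp_apply _ _ ⟨φ.comp (π i), hker i⟩ x
  refine isInternal_of_projections _ ψ ?_ ?_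
  · rintro i j _ ⟨_, ⟨x, rfl⟩, rfl⟩
    rw [hψ, hπ]
    split_ifs
    · rfl
    · exact map_zero φ
  · rw [← AddSubgroup.map_iSup, htop, AddSubgroup.map_top_of_surjective φ hφ]

end Internal

section Ring

variable (k : Type u) [Field k]

/-- The cubic as a monic polynomial in `y₁` over `k[y₂, y₃]`. -/
def monicCubic : Polynomial (MvPolynomial (Fin 2) k) :=
  Polynomial.X ^ 3 + Polynomial.C (X 1) * Polynomial.X ^ 2 - Polynomial.C (X 0 ^ 2 * X 1)

theorem finSuccEquiv_cubic : finSuccEquiv k 2 (cubic k) = monicCubic k := by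
  have h1 : finSuccEquiv k 2 (X 1) = Polynomial.C (X 0) := finSuccEquiv_X_succ (j := 0)
  have h2 : finSuccEquiv k 2 (X 2) = Polynomial.C (X 1) := finSuccEquiv_X_succ (j := 1)
  simp only [cubic, monicCubic, map_add, map_sub, map_mul, map_pow, finSuccEquiv_X_zero, h1, h2]
  ring

theorem natDegree_monicCubic : (monicCubic k).natDegree = 3 := by
  unfold monicCubic
  compute_degree!

theorem monic_monicCubic : (monicCubic k).Monic := by
  unfold monicCubic
  monicity!

theorem coeff_zero_monicCubic : (monicCubic k).coeff 0 = -(X 0 ^ 2 * X 1) := by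
  simp [monicCubic, Polynomial.coeff_zero_eq_eval_zero]

theorem X_dvd_coeff_monicCubic {n : ℕ} (hn : n < 3) : X 1 ∣ (monicCubic k).coeff n := by
  interval_cases n
  · simp [monicCubic]
  · simp [monicCubic, Polynomial.coeff_X_pow]
  · simp [monicCubic, Polynomial.coeff_X_pow]

theorem not_X_sq_dvd_coeff_zero_monicCubic : ¬ X 1 ^ 2 ∣ (monicCubic k).coeff 0 := by
  rw [coeff_zero_monicCubic, dvd_neg, pow_two (X 1), mul_dvd_mul_iff_right (X_ne_zero 1)]
  intro h
  simpa [X_dvd_X] using X_prime.dvd_of_dvd_pow h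

theorem irreducible_monicCubic : Irreducible (monicCubic k) := by
  have hp : (Ideal.span {(X 1 : MvPolynomial (Fin 2) k)}).IsPrime :=
    (Ideal.span_singleton_prime (X_ne_zero 1)).2 X_prime
  refine Polynomial.IsEisensteinAt.irreducible (𝓟 := Ideal.span {X 1}) ⟨?_, ?_, ?_⟩ hp
    (monic_monicCubic k).isPrimitive (by simp [natDegree_monicCubic])
  · rw [(monic_monicCubic k).leadingCoeff]
    exact fun h => hp.ne_top ((Ideal.eq_top_iff_one _).2 h)
  · intro n hn
    rw [natDegree_monicCubic] at hn
    exact Ideal.mem_span_singleton.2 (X_dvd_coeff_monicCubic k hn)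
  · rw [Ideal.span_singleton_pow, Ideal.mem_span_singleton]
    exact not_X_sq_dvd_coeff_zero_monicCubic k

theorem prime_cubic : Prime (cubic k) :=
  (MulEquiv.prime_iff (finSuccEquiv k 2)).1 <| by
    rw [finSuccEquiv_cubic]
    exact (irreducible_monicCubic k).prime

instance instIsDomainNodeRing : IsDomain (NodeRing k) :=
  (Ideal.Quotient.isDomain_iff_prime _).2
    ((Ideal.span_singleton_prime (prime_cubic k).ne_zero).2 (prime_cubic k))

variable {k} in
theorem quot_eq_zero_iff {p : MvPolynomial (Fin 3) k} : quot k p = 0 ↔ cubic k ∣ p := by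
  rw [Ideal.Quotient.eq_zero_iff_mem, Ideal.mem_span_singleton]

theorem quot_cubic : quot k (cubic k) = 0 :=
  quot_eq_zero_iff.2 dvd_rfl

theorem isHomogeneous_cubic : (cubic k).IsHomogeneous 3 := by
  have hX := isHomogeneous_X (σ := Fin 3) k
  exact (((hX 0).pow 3).add (((hX 0).pow 2).mul (hX 2))).sub (((hX 1).pow 2).mul (hX 2))

variable {k} in
theorem quot_ne_zero_of_isHomogeneous {p : MvPolynomial (Fin 3) k} {n : ℕ}
    (hp : p.IsHomogeneous n) (hp0 : p ≠ 0) (hn : n < 3) : quot k p ≠ 0 := by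
  rw [Ne, quot_eq_zero_iff]
  rintro ⟨q, rfl⟩
  have hdeg := hp.totalDegree hp0
  rw [totalDegree_mul_of_isDomain (prime_cubic k).ne_zero (right_ne_zero_of_mul hp0),
    (isHomogeneous_cubic k).totalDegree (prime_cubic k).ne_zero] at hdeg
  omega

theorem quot_X_ne_zero (i : Fin 3) : quot k (X i) ≠ 0 :=
  quot_ne_zero_of_isHomogeneous (isHomogeneous_X k i) (X_ne_zero i) (by norm_num)

/-- The structure of `R` as an algebra over `k[y₂, y₃]`. The variables of `MvPolynomial (Fin 2) k`
are numbered from zero, so `X 0` acts as `y₂` and `X 1` as `y₃`. -/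
instance instAlgebraNodeRing : Algebra (MvPolynomial (Fin 2) k) (NodeRing k) :=
  ((quot k).comp (rename Fin.succ : MvPolynomial (Fin 2) k →ₐ[k] _).toRingHom).toAlgebra

instance instModuleNodeRing : Module (MvPolynomial (Fin 2) k) (NodeRing k) :=
  (instAlgebraNodeRing k).toModule

theorem algebraMap_eq (a : MvPolynomial (Fin 2) k) :
    algebraMap (MvPolynomial (Fin 2) k) (NodeRing k) a = quot k (rename Fin.succ a) := rfl

theorem finSuccEquiv_rename_succ (a : MvPolynomial (Fin 2) k) :
    finSuccEquiv k 2 (rename Fin.succ a) = Polynomial.C a := by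
  induction a using MvPolynomial.induction_on with
  | C r => simp [finSuccEquiv_apply]
  | add p q hp hq => simp [hp, hq]
  | mul_X p i hp => simp only [map_mul, hp, rename_X, finSuccEquiv_X_succ]

/-- The identification of `R` with the quotient of `k[y₂, y₃][y₁]` by the monic cubic. -/
def quotientFinSuccEquiv : NodeRing k ≃+* AdjoinRoot (monicCubic k) :=
  Ideal.quotientEquiv (Ideal.span {cubic k}) (Ideal.span {monicCubic k})
    (finSuccEquiv k 2).toRingEquiv (by
      rw [Ideal.map_span, Set.image_singleton]
      exact congrArg (fun p => Ideal.span {p}) (finSuccEquiv_cubic k).symm)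

theorem quotientFinSuccEquiv_quot (p : MvPolynomial (Fin 3) k) :
    quotientFinSuccEquiv k (quot k p) = AdjoinRoot.mk _ (finSuccEquiv k 2 p) := rfl

/-- `R` is obtained from `k[y₂, y₃]` by adjoining a root of the monic cubic. -/
def adjoinRootEquiv : AdjoinRoot (monicCubic k) ≃ₐ[MvPolynomial (Fin 2) k] NodeRing k :=
  (AlgEquiv.ofRingEquiv (f := quotientFinSuccEquiv k) fun a => by
    rw [algebraMap_eq, quotientFinSuccEquiv_quot, finSuccEquiv_rename_succ]
    rfl).symm

theorem adjoinRootEquiv_root : adjoinRootEquiv k (AdjoinRoot.root _) = quot k (X 0) := by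
  rw [adjoinRootEquiv, AlgEquiv.symm_apply_eq]
  change _ = quotientFinSuccEquiv k (quot k (X 0))
  rw [quotientFinSuccEquiv_quot, finSuccEquiv_X_zero]
  rfl

/-- The power basis `1, y₁, y₁²` of `R` over `k[y₂, y₃]`. -/
def nodePowerBasis : PowerBasis (MvPolynomial (Fin 2) k) (NodeRing k) :=
  (AdjoinRoot.powerBasis' (monic_monicCubic k)).map (adjoinRootEquiv k)

theorem nodePowerBasis_gen : (nodePowerBasis k).gen = quot k (X 0) := by
  simp [nodePowerBasis, adjoinRootEquiv_root]

theorem nodePowerBasis_dim : (nodePowerBasis k).dim = 3 := by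
  simp [nodePowerBasis, natDegree_monicCubic]

instance instFreeNodeRing : Module.Free (MvPolynomial (Fin 2) k) (NodeRing k) :=
  .of_basis (nodePowerBasis k).basis

instance instFiniteNodeRing : Module.Finite (MvPolynomial (Fin 2) k) (NodeRing k) :=
  (nodePowerBasis k).finite

theorem finrank_nodeRing : Module.finrank (MvPolynomial (Fin 2) k) (NodeRing k) = 3 := by
  rw [(nodePowerBasis k).finrank, nodePowerBasis_dim]

theorem linearIndependent_pow :
    LinearIndependent (MvPolynomial (Fin 2) k) fun i : Fin 3 => quot k (X 0) ^ (i : ℕ) := by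
  have h := (nodePowerBasis k).basis.linearIndependent.comp
    (Fin.cast (nodePowerBasis_dim k).symm) (Fin.cast_injective _)
  simpa [Function.comp_def, nodePowerBasis_gen] using h

theorem isWeaklyRegular_nodeRing :
    RingTheory.Sequence.IsWeaklyRegular (NodeRing k) [quot k (X 2), quot k (X 1)] := by
  have h := (isWeaklyRegular_pair_of_prime (X_prime (R := k) (i := (1 : Fin 2)))
    (s := X 0) (by simp [X_dvd_X])).of_flat (S := NodeRing k)
  simpa [algebraMap_eq] using h

/-- The evaluation of `R` at the origin. -/
def evalZero : NodeRing k →+* k :=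
  Ideal.Quotient.lift _ (eval (0 : Fin 3 → k)) fun a ha => by
    obtain ⟨q, rfl⟩ := Ideal.mem_span_singleton.1 ha
    simp [cubic]

@[simp]
theorem evalZero_quot (p : MvPolynomial (Fin 3) k) : evalZero k (quot k p) = eval 0 p := rfl

instance instRingHomSurjectiveEvalZero : RingHomSurjective (evalZero k) :=
  ⟨fun r => ⟨quot k (C r), by simp⟩⟩

/-- The restriction of `R` to the line `y₁ = y₂ = 0`, which lies on the cone `f = 0`. -/
def evalLine : NodeRing k →+* Polynomial k :=
  Ideal.Quotient.lift _ (eval₂Hom Polynomial.C ![0, 0, Polynomial.X]) fun a ha => by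
    obtain ⟨q, rfl⟩ := Ideal.mem_span_singleton.1 ha
    simp [cubic]

theorem evalLine_surjective : Function.Surjective (evalLine k) := by
  have h : (evalLine k).comp ((quot k).comp (Polynomial.aeval (X 2)).toRingHom) =
      RingHom.id (Polynomial k) := by
    ext <;> simp [evalLine]
  exact fun p => ⟨quot k (Polynomial.aeval (X 2) p), RingHom.congr_fun h p⟩

theorem ringKrullDim_nodeRing : ringKrullDim (NodeRing k) = 2 := by
  apply le_antisymm
  · have h : ringKrullDim (NodeRing k) + 1 ≤ ringKrullDim (MvPolynomial (Fin 3) k) :=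
      ringKrullDim_quotient_succ_le_of_nonZeroDivisor
        (mem_nonZeroDivisors_of_ne_zero (prime_cubic k).ne_zero)
    rw [MvPolynomial.ringKrullDim_of_isNoetherianRing, ringKrullDim_eq_zero_of_field,
      Nat.card_eq_fintype_card, Fintype.card_fin, zero_add] at h
    exact ENat.WithBot.add_le_add_one_right_iff.1 (h.trans (by norm_num))
  · have h : ringKrullDim (Polynomial k) + 1 ≤ ringKrullDim (NodeRing k) :=
      ringKrullDim_succ_le_of_surjective (evalLine k) (evalLine_surjective k)
        (mem_nonZeroDivisors_of_ne_zero (quot_X_ne_zero k 0)) (by simp [evalLine])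
    rw [Polynomial.ringKrullDim_of_isNoetherianRing, ringKrullDim_eq_zero_of_field] at h
    exact le_trans (by norm_num) h

variable {k}

theorem quot_mem_ringDeg {p : MvPolynomial (Fin 3) k} {n : ℕ} (hp : p.IsHomogeneous n) :
    quot k p ∈ ringDeg k n :=
  ⟨p, hp, rfl⟩

theorem ringDeg_eq_map_range (n : ℤ) :
    ringDeg k n = (intComponent n).toAddMonoidHom.range.map (quot k).toAddMonoidHom := by
  rcases n with n | n
  · refine congrArg (AddSubgroup.map _) (AddSubgroup.ext fun p => ?_)
    constructor
    · exact fun hp => ⟨p, (intComponent_natCast n p).trans (homogeneousComponent_eq_self hp)⟩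
    · rintro ⟨q, rfl⟩
      exact (intComponent_natCast n q).symm ▸ homogeneousComponent_isHomogeneous n q
  · have hzero : (intComponent (Int.negSucc n)).toAddMonoidHom =
        (0 : MvPolynomial (Fin 3) k →+ _) :=
      AddMonoidHom.ext (intComponent_of_neg (Int.negSucc_lt_zero n))
    rw [hzero]
    simp [ringDeg]

theorem mul_mem_ringDeg {m n : ℤ} {r s : NodeRing k} (hr : r ∈ ringDeg k m)
    (hs : s ∈ ringDeg k n) : r * s ∈ ringDeg k (m + n) := by
  rw [ringDeg_eq_map_range] at hs ⊢
  rcases m with m | m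
  · obtain ⟨p, hp, rfl⟩ := hr
    obtain ⟨_, ⟨q, rfl⟩, rfl⟩ := hs
    refine ⟨p * intComponent n q, ⟨p * q, ?_⟩, map_mul (quot k) _ _⟩
    change intComponent _ (p * q) = _
    rw [intComponent_mul hp, Int.ofNat_eq_natCast, add_sub_cancel_left]
  · rw [AddSubgroup.mem_bot.1 hr, zero_mul]
    exact zero_mem _

end Ring

section Coker

variable {k : Type u} [Field k] {A : Matrix (Fin 3) (Fin 3) (MvPolynomial (Fin 3) k)}

/-- The class in `Coker A` of a vector of polynomials. -/
def cokerMk (A : Matrix (Fin 3) (Fin 3) (MvPolynomial (Fin 3) k)) :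
    (Fin 3 → MvPolynomial (Fin 3) k) →+ Coker A :=
  (LinearMap.range (Matrix.mulVecLin (A.map (quot k)))).mkQ.toAddMonoidHom.comp
    ((quot k).toAddMonoidHom.compLeft (Fin 3))

theorem cokerMk_surjective : Function.Surjective (cokerMk A) :=
  (Submodule.mkQ_surjective _).comp Ideal.Quotient.mk_surjective.comp_left

theorem cokerMk_smul (p : MvPolynomial (Fin 3) k) (x : Fin 3 → MvPolynomial (Fin 3) k) :
    cokerMk A (p • x) = quot k p • cokerMk A x := by
  have hsmul : quot k ∘ (p • x) = quot k p • (quot k ∘ x) := _root_.funext fun i => map_mul _ _ _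
  exact (congrArg (Submodule.mkQ _) hsmul).trans
    (LinearMap.map_smul (Submodule.mkQ _) (quot k p) (quot k ∘ x))

theorem cokerMk_eq_zero_iff {x : Fin 3 → MvPolynomial (Fin 3) k} :
    cokerMk A x = 0 ↔ ∃ w z, x = A.mulVec w + cubic k • z := by
  have hzero : cokerMk A x = 0 ↔ ∃ w, (A.map (quot k)).mulVec w = quot k ∘ x :=
    Submodule.Quotient.mk_eq_zero _
  rw [hzero]
  constructor
  · rintro ⟨w, hw⟩
    obtain ⟨w, rfl⟩ : ∃ v : Fin 3 → MvPolynomial (Fin 3) k, quot k ∘ v = w :=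
      Ideal.Quotient.mk_surjective.comp_left w
    have hdvd (i : Fin 3) : cubic k ∣ x i - A.mulVec w i := by
      rw [← quot_eq_zero_iff, map_sub, sub_eq_zero, RingHom.map_mulVec]
      exact (congrFun hw i).symm
    choose z hz using hdvd
    exact ⟨w, z, funext fun i => eq_add_of_sub_eq' (hz i)⟩
  · rintro ⟨w, z, rfl⟩
    refine ⟨quot k ∘ w, funext fun i => ?_⟩
    simp [← RingHom.map_mulVec]

/-- The projection of `S(-1)³` onto its component of degree `j`. -/
def vecComponent (k : Type u) [Field k] (j : ℤ) :
    (Fin 3 → MvPolynomial (Fin 3) k) →+ (Fin 3 → MvPolynomial (Fin 3) k) :=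
  (intComponent (j - 1)).toAddMonoidHom.compLeft (Fin 3)

theorem vecComponent_apply (j : ℤ) (x : Fin 3 → MvPolynomial (Fin 3) k) :
    vecComponent k j x = intComponent (j - 1) ∘ x := rfl

theorem vecComponent_vecComponent (i j : ℤ) (x : Fin 3 → MvPolynomial (Fin 3) k) :
    vecComponent k i (vecComponent k j x) = if i = j then vecComponent k j x else 0 := by
  funext l
  rw [vecComponent_apply, vecComponent_apply, Function.comp_apply, Function.comp_apply,
    intComponent_intComponent]
  simp only [sub_left_inj]
  split_ifs <;> rfl

theorem iSup_range_vecComponent : ⨆ j, (vecComponent k j).range = ⊤ := by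
  refine eq_top_iff.2 fun x _ => ?_
  rw [← Finset.univ_sum_single x]
  refine sum_mem fun i _ => ?_
  rw [← sum_intComponent (x i), ← AddMonoidHom.single_apply, map_sum]
  refine sum_mem fun n _ => AddSubgroup.mem_iSup_of_mem (n + 1 : ℤ) ⟨Pi.single i (x i), ?_⟩
  funext l
  rw [vecComponent_apply, Function.comp_apply, add_sub_cancel_right, AddMonoidHom.single_apply]
  rcases eq_or_ne l i with rfl | hl
  · simp only [Pi.single_eq_same]
  · simp only [Pi.single_eq_of_ne hl, map_zero]

theorem cokerDeg_eq_map_range (A : Matrix (Fin 3) (Fin 3) (MvPolynomial (Fin 3) k)) (j : ℤ) :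
    cokerDeg A j = (vecComponent k j).range.map (cokerMk A) := by
  rw [cokerDeg, cokerMk, ← AddSubgroup.map_map]
  refine congrArg (AddSubgroup.map _) (AddSubgroup.ext fun x => ?_)
  simp only [ringDeg_eq_map_range]
  constructor
  · intro hx
    choose y hy using fun i => hx i trivial
    choose z hz using fun i => (hy i).1
    exact ⟨y, ⟨z, funext hz⟩, funext fun i => (hy i).2⟩
  · rintro ⟨_, ⟨z, rfl⟩, rfl⟩ i -
    exact ⟨_, ⟨z i, rfl⟩, rfl⟩

theorem isGraded_cokerDeg {d : ℕ} (hA : ∀ i j, (A i j).IsHomogeneous d) :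
    IsGraded (k := k) (cokerDeg A) := by
  constructor
  · rw [funext (cokerDeg_eq_map_range A)]
    refine isInternal_map_of_projections (vecComponent k) vecComponent_vecComponent
      iSup_range_vecComponent _ cokerMk_surjective fun j x hx => ?_
    obtain ⟨w, z, rfl⟩ := cokerMk_eq_zero_iff.1 hx
    refine cokerMk_eq_zero_iff.2 ⟨intComponent (j - 1 - d) ∘ w, intComponent (j - 1 - 3) ∘ z, ?_⟩
    rw [map_add, vecComponent_apply, intComponent_mulVec hA]
    exact congrArg _ (funext fun i => intComponent_mul (isHomogeneous_cubic k) _ _)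
  · rintro i j r _ hr ⟨x, hx, rfl⟩
    refine ⟨r • x, fun l _ => ?_, map_smul (Submodule.mkQ _) r x⟩
    rw [add_sub_assoc]
    exact mul_mem_ringDeg hr (hx l trivial)

/-- The reduction of the cokernel of a matrix of linear forms modulo the irrelevant ideal. -/
def cokerEvalZero (hA : ∀ i j, (A i j).IsHomogeneous 1) : Coker A →ₛₗ[evalZero k] (Fin 3 → k) :=
  Submodule.liftQ _
    { toFun := fun x i => evalZero k (x i)
      map_add' := fun x y => by ext i; simp
      map_smul' := fun r x => by ext i; simp }
    (by
      rw [Matrix.range_mulVecLin, Submodule.span_le]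
      rintro _ ⟨j, rfl⟩
      ext i
      change eval 0 (A i j) = 0
      rw [eval_zero, constantCoeff_eq]
      exact (hA i j).coeff_eq_zero (by simp))

theorem cokerEvalZero_mk (hA : ∀ i j, (A i j).IsHomogeneous 1) (x : Fin 3 → NodeRing k)
    (i : Fin 3) : cokerEvalZero hA (Submodule.Quotient.mk x) i = evalZero k (x i) := rfl

theorem cokerEvalZero_surjective (hA : ∀ i j, (A i j).IsHomogeneous 1) :
    Function.Surjective (cokerEvalZero hA) := by
  intro x
  refine ⟨Submodule.Quotient.mk fun i => quot k (C (x i)), ?_⟩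
  ext i
  simp [cokerEvalZero_mk]

theorem isMinimallyGenerated_coker (hA : ∀ i j, (A i j).IsHomogeneous 1) :
    IsMinimallyGenerated k (Coker A) 3 := by
  apply le_antisymm
  · have h := Submodule.spanRank_range_le
      (LinearMap.range (Matrix.mulVecLin (A.map (quot k)))).mkQ
    rw [Submodule.range_mkQ] at h
    refine h.trans (le_of_eq ?_)
    rw [← Submodule.rank_eq_spanRank_of_free, rank_fun', Fintype.card_fin]
  · have h := Submodule.spanRank_range_le (cokerEvalZero hA)
    rwa [LinearMap.range_eq_top.2 (cokerEvalZero_surjective hA),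
      ← Submodule.rank_eq_spanRank_of_free, rank_fun', Fintype.card_fin] at h

theorem quot_X_mem_irrelevant (i : Fin 3) : quot k (X i) ∈ irrelevant k :=
  Ideal.subset_span ⟨i, rfl⟩

theorem irrelevant_le_ker_evalZero : irrelevant k ≤ RingHom.ker (evalZero k) := by
  rw [irrelevant, Ideal.span_le]
  rintro _ ⟨i, rfl⟩
  simp [RingHom.mem_ker]

theorem irrelevant_smul_top_ne_top (hA : ∀ i j, (A i j).IsHomogeneous 1) :
    irrelevant k • (⊤ : Submodule (NodeRing k) (Coker A)) ≠ ⊤ := by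
  intro htop
  have hle : irrelevant k • (⊤ : Submodule (NodeRing k) (Coker A)) ≤
      LinearMap.ker (cokerEvalZero hA) := by
    refine Submodule.smul_le.2 fun r hr x _ => ?_
    have hr0 : evalZero k r = 0 := irrelevant_le_ker_evalZero hr
    rw [LinearMap.mem_ker, map_smulₛₗ, hr0, zero_smul]
  obtain ⟨x, hx⟩ := cokerEvalZero_surjective hA 1
  have hx0 : cokerEvalZero hA x = 0 := (htop ▸ hle) Submodule.mem_top
  exact one_ne_zero (hx.symm.trans hx0)

end Coker

section Alpha

variable {k : Type u} [Field k] {a b : k}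

theorem det_alpha (h : b ^ 2 = a ^ 3 + a ^ 2) : (alpha a b).det = cubic k := by
  have hC : (C b : MvPolynomial (Fin 3) k) ^ 2 = C a ^ 3 + C a ^ 2 := by
    rw [← C_pow, h, C_add, C_pow, C_pow]
  rw [Matrix.det_fin_three]
  simp only [alpha, cubic, Matrix.of_apply, Matrix.cons_val', Matrix.cons_val_zero,
    Matrix.cons_val_one, Matrix.cons_val, C_add, C_pow, C_1]
  linear_combination (X 2 ^ 3) * hC

theorem alpha_mul_beta (h : b ^ 2 = a ^ 3 + a ^ 2) :
    alpha a b * beta a b = cubic k • (1 : Matrix (Fin 3) (Fin 3) (MvPolynomial (Fin 3) k)) := by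
  rw [beta, Matrix.mul_adjugate, det_alpha h]

theorem beta_mul_alpha (h : b ^ 2 = a ^ 3 + a ^ 2) :
    beta a b * alpha a b = cubic k • (1 : Matrix (Fin 3) (Fin 3) (MvPolynomial (Fin 3) k)) := by
  rw [beta, Matrix.adjugate_mul, det_alpha h]

theorem isHomogeneous_alpha (a b : k) (i j : Fin 3) : (alpha a b i j).IsHomogeneous 1 := by
  have hX := isHomogeneous_X (σ := Fin 3) k
  have hCX := fun c : k => isHomogeneous_C_mul_X c (2 : Fin 3)
  have hzero := isHomogeneous_zero (Fin 3) k 1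
  fin_cases i <;> fin_cases j
  · exact hzero
  · exact (hX 0).sub (hCX a)
  · exact (hX 1).sub (hCX b)
  · exact hX 0
  · exact (hX 1).add (hCX b)
  · exact hCX (a ^ 2 + a)
  · exact hX 2
  · exact hzero
  · exact (hX 0).neg.sub (hCX (a + 1))

theorem isMatrixFactorization_alpha (h : b ^ 2 = a ^ 3 + a ^ 2) :
    IsMatrixFactorization (cubic k) (alpha a b) (beta a b) :=
  ⟨fun i j => ⟨1, isHomogeneous_alpha a b i j⟩,
    fun i j => ⟨2 * 1, isHomogeneous_adjugate (isHomogeneous_alpha a b) i j⟩,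
    alpha_mul_beta h, beta_mul_alpha h⟩

theorem cubic_mem_nonZeroDivisors : cubic k ∈ nonZeroDivisors (MvPolynomial (Fin 3) k) :=
  mem_nonZeroDivisors_of_ne_zero (prime_cubic k).ne_zero

theorem isRegular_coker_alpha (h : b ^ 2 = a ^ 3 + a ^ 2) :
    RingTheory.Sequence.IsRegular (Coker (alpha a b)) [quot k (X 2), quot k (X 1)] := by
  constructor
  · rw [(cokerEquivKer cubic_mem_nonZeroDivisors (alpha_mul_beta h)
      (beta_mul_alpha h)).isWeaklyRegular_congr]
    exact isWeaklyRegular_pair_ker _ (isWeaklyRegular_pair_pi (isWeaklyRegular_nodeRing k))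
      (.pi fun _ => IsSMulRegular.of_ne_zero (quot_X_ne_zero k 2))
  · intro htop
    refine irrelevant_smul_top_ne_top (isHomogeneous_alpha a b)
      (top_le_iff.1 (htop.le.trans (Submodule.smul_mono_left ?_)))
    simp [Ideal.span_le, quot_X_mem_irrelevant]

theorem isGradedMCM_coker_alpha (h : b ^ 2 = a ^ 3 + a ^ 2) :
    IsGradedMCM (k := k) (cokerDeg (alpha a b)) := by
  refine ⟨inferInstance, isGraded_cokerDeg (isHomogeneous_alpha a b),
    [quot k (X 2), quot k (X 1)], ?_, by rw [ringKrullDim_nodeRing]; rfl, isRegular_coker_alpha h⟩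
  simp [quot_X_mem_irrelevant]

theorem eq_zero_of_alpha_mulVec_eq_zero {x : Fin 3 → NodeRing k}
    (hx : ((alpha a b).map (quot k)).mulVec x = 0) (hx2 : x 2 = 0) : x = 0 := by
  have hline : quot k (X 0 - C a * X 2) ≠ 0 := by
    refine quot_ne_zero_of_isHomogeneous ((isHomogeneous_X k 0).sub (isHomogeneous_C_mul_X a 2))
      (fun h0 => ?_) (by norm_num)
    simpa using congrArg (eval ![1, 0, 0]) h0
  have h0 : quot k (X 2) * x 0 = 0 := by
    simpa [alpha, Matrix.mulVec, dotProduct, Fin.sum_univ_three, hx2] using congrFun hx 2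
  have h1 : quot k (X 0 - C a * X 2) * x 1 = 0 := by
    simpa [alpha, Matrix.mulVec, dotProduct, Fin.sum_univ_three, hx2] using congrFun hx 0
  funext i
  fin_cases i
  · exact (mul_eq_zero.1 h0).resolve_left (quot_X_ne_zero k 2)
  · exact (mul_eq_zero.1 h1).resolve_left hline
  · exact hx2

/-- The embedding of the cokernel of `α` into `R` by the last coordinate of its image in `R³`. -/
def cokerToRing (h : b ^ 2 = a ^ 3 + a ^ 2) : Coker (alpha a b) →ₗ[NodeRing k] NodeRing k :=
  (LinearMap.proj 2 ∘ₗ (LinearMap.ker _).subtype) ∘ₗ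
    (cokerEquivKer cubic_mem_nonZeroDivisors (alpha_mul_beta h) (beta_mul_alpha h)).toLinearMap

theorem cokerToRing_injective (h : b ^ 2 = a ^ 3 + a ^ 2) :
    Function.Injective (cokerToRing h) := by
  rw [cokerToRing, LinearMap.coe_comp]
  refine Function.Injective.comp ?_ (LinearEquiv.injective _)
  refine (injective_iff_map_eq_zero _).2 fun x hx => Subtype.ext ?_
  exact eq_zero_of_alpha_mulVec_eq_zero x.2 hx

theorem rank_eq_one_of_injective {R M : Type u} [CommRing R] [IsDomain R] [AddCommGroup M]
    [Module R M] [Nontrivial M] (φ : M →ₗ[R] R) (hφ : Function.Injective φ) :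
    Module.rank R M = 1 := by
  have : Module.IsTorsionFree R M := hφ.moduleIsTorsionFree φ (map_smul φ)
  refine le_antisymm ?_ (Cardinal.one_le_iff_pos.2 rank_pos)
  exact (LinearMap.rank_le_of_injective φ hφ).trans_eq (Module.rank_self R)

theorem rank_coker_alpha (h : b ^ 2 = a ^ 3 + a ^ 2) :
    Module.rank (NodeRing k) (Coker (alpha a b)) = 1 :=
  have := (cokerEvalZero_surjective (isHomogeneous_alpha a b)).nontrivial
  rank_eq_one_of_injective (cokerToRing h) (cokerToRing_injective h)

end Alpha

section Morphisms

variable {k : Type u} [Field k] {A B : Matrix (Fin 3) (Fin 3) (MvPolynomial (Fin 3) k)}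

theorem map_cokerMk_eq_mulVec (φ : Coker A →ₗ[NodeRing k] Coker B)
    {U : Matrix (Fin 3) (Fin 3) (MvPolynomial (Fin 3) k)}
    (hU : ∀ j, φ (cokerMk A (Pi.single j 1)) = cokerMk B (U.col j))
    (x : Fin 3 → MvPolynomial (Fin 3) k) : φ (cokerMk A x) = cokerMk B (U.mulVec x) := by
  rw [← Finset.univ_sum_single x, Matrix.mulVec_sum, map_sum, map_sum, map_sum]
  refine Finset.sum_congr rfl fun j _ => ?_
  have hsingle : Pi.single j (x j) = x j • (Pi.single j 1 : Fin 3 → MvPolynomial (Fin 3) k) := by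
    rw [← Pi.single_smul, smul_eq_mul, mul_one]
  rw [hsingle, Matrix.mulVec_smul, Matrix.mulVec_single_one, cokerMk_smul, cokerMk_smul, map_smul,
    hU]

theorem map_constantCoeff_mul_eq_of_mul_eq (hA : ∀ i j, (A i j).IsHomogeneous 1)
    (hB : ∀ i j, (B i j).IsHomogeneous 1)
    {U W Z : Matrix (Fin 3) (Fin 3) (MvPolynomial (Fin 3) k)} (h : U * A = B * W + cubic k • Z) :
    (U.map constantCoeff).map C * A = B * (W.map constantCoeff).map C := by
  have hconst (V : Fin 3 → MvPolynomial (Fin 3) k) :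
      intComponent (1 - (1 : ℕ)) ∘ V = fun i => C (constantCoeff (V i)) := by
    funext i
    rw [Nat.cast_one, sub_self, Function.comp_apply, intComponent_zero]
  ext1 i j
  have hleft : intComponent 1 ((U * A) i j) = ((U.map constantCoeff).map C * A :) i j := by
    have h := congrFun (intComponent_mulVec (A := A.transpose) (fun i j => hA j i) 1 (U i)) j
    rwa [hconst, Matrix.mulVec_transpose, Matrix.mulVec_transpose] at h
  have hright : intComponent 1 ((B * W) i j) = (B * (W.map constantCoeff).map C :) i j := by
    have h := congrFun (intComponent_mulVec hB 1 (W.col j)) i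
    rwa [hconst] at h
  have hcubic : intComponent 1 (cubic k * Z i j) = 0 := by
    rw [intComponent_mul (isHomogeneous_cubic k), intComponent_of_neg (by norm_num), mul_zero]
  rw [← hleft, h, Matrix.add_apply, map_add, hright, Matrix.smul_apply, smul_eq_mul, hcubic,
    add_zero]

theorem exists_constant_matrices_of_linearMap (hA : ∀ i j, (A i j).IsHomogeneous 1)
    (hB : ∀ i j, (B i j).IsHomogeneous 1) (φ : Coker A →ₗ[NodeRing k] Coker B) :
    ∃ U W : Matrix (Fin 3) (Fin 3) k,
      (∀ x, cokerEvalZero hB (φ x) = U.mulVec (cokerEvalZero hA x)) ∧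
        U.map C * A = B * W.map C := by
  choose U hU using fun j : Fin 3 => cokerMk_surjective (φ (cokerMk A (Pi.single j 1)))
  replace hU := map_cokerMk_eq_mulVec φ (U := Matrix.of fun i j => U j i) fun j => (hU j).symm
  set U := Matrix.of fun i j => U j i
  have hrel (j : Fin 3) : ∃ w z, U.mulVec (A.col j) = B.mulVec w + cubic k • z := by
    have hcol : cokerMk A (A.col j) = 0 :=
      cokerMk_eq_zero_iff.2 ⟨Pi.single j 1, 0, by simp⟩
    rw [← cokerMk_eq_zero_iff, ← hU, hcol, map_zero]
  choose W Z hWZ using hrel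
  refine ⟨U.map constantCoeff, (Matrix.of fun i j => W j i).map constantCoeff, fun x => ?_,
    map_constantCoeff_mul_eq_of_mul_eq hA hB (Z := Matrix.of fun i j => Z j i)
      (Matrix.ext fun i j => congrFun (hWZ j) i)⟩
  obtain ⟨x, rfl⟩ := cokerMk_surjective x
  have hred (D : Matrix (Fin 3) (Fin 3) (MvPolynomial (Fin 3) k))
      (hD : ∀ i j, (D i j).IsHomogeneous 1) (y : Fin 3 → MvPolynomial (Fin 3) k) :
      cokerEvalZero hD (cokerMk D y) = constantCoeff ∘ y :=
    funext fun i => by rw [← eval_zero]; rfl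
  rw [hU, hred, hred]
  exact funext (RingHom.map_mulVec constantCoeff U x)

theorem map_eval_alpha (a b : k) (v : Fin 3 → k) :
    (alpha a b).map (eval v) = !![0, v 0 - a * v 2, v 1 - b * v 2;
      v 0, v 1 + b * v 2, (a ^ 2 + a) * v 2;
      v 2, 0, -v 0 - (a + 1) * v 2] := by
  ext i j
  fin_cases i <;> fin_cases j <;> simp [alpha]

theorem alpha_parameters_eq {a b c d : k} {U W : Matrix (Fin 3) (Fin 3) k}
    (h : U.map C * alpha a b = alpha c d * W.map C) (hU : IsUnit U) : a = c ∧ b = d := by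
  have heval (v : Fin 3 → k) :
      U * (alpha a b).map (eval v) = (alpha c d).map (eval v) * W := by
    have hconst (V : Matrix (Fin 3) (Fin 3) k) : (eval v).mapMatrix (V.map C) = V := by
      ext i j
      simp
    have hmap := congrArg (eval v).mapMatrix h
    rwa [map_mul, map_mul, hconst, hconst] at hmap
  simp only [map_eval_alpha] at heval
  have h1 := Matrix.ext_iff.2 (heval ![1, 0, 0])
  have h2 := Matrix.ext_iff.2 (heval ![0, 1, 0])
  have h3 := Matrix.ext_iff.2 (heval ![0, 0, 1])
  simp only [Matrix.cons_val_zero, Matrix.cons_val, mul_zero, sub_zero, Matrix.cons_val_one,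
    sub_self, add_zero, Matrix.mul_apply, Matrix.of_apply, Matrix.cons_val',
    Matrix.cons_val_fin_one, Fin.sum_univ_three, Fin.forall_fin_succ, mul_one, zero_add,
    Matrix.cons_val_succ, Fin.succ_zero_eq_one, mul_neg, Fin.succ_one_eq_two, IsEmpty.forall_iff,
    and_true, zero_mul, one_mul, neg_mul, neg_inj, neg_zero, true_and, zero_sub,
    neg_add_rev] at h1 h2 h3
  have hentry : U 2 2 ≠ 0 := by
    intro h0
    have hdet : U.det = 0 := by
      rw [Matrix.det_fin_three]
      grind
    rw [Matrix.isUnit_iff_isUnit_det, hdet] at hU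
    exact not_isUnit_zero hU
  exact ⟨mul_left_cancel₀ hentry (by grind), mul_left_cancel₀ hentry (by grind)⟩

theorem alpha_parameters_eq_of_equiv {a b c d : k}
    (e : Coker (alpha a b) ≃ₗ[NodeRing k] Coker (alpha c d)) : a = c ∧ b = d := by
  have hA := isHomogeneous_alpha a b
  have hB := isHomogeneous_alpha c d
  obtain ⟨U, W, hU, hUW⟩ := exists_constant_matrices_of_linearMap hA hB e.toLinearMap
  obtain ⟨U', -, hU', -⟩ := exists_constant_matrices_of_linearMap hB hA e.symm.toLinearMap
  refine alpha_parameters_eq hUW (IsUnit.of_mul_eq_one_right U' ?_)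
  apply Matrix.ext_of_mulVec_single
  intro i
  obtain ⟨x, hx⟩ := cokerEvalZero_surjective hA (Pi.single i 1)
  rw [← hx, ← Matrix.mulVec_mulVec, ← hU, ← hU', Matrix.one_mulVec]
  exact congrArg _ (e.symm_apply_apply x)

end Morphisms

section Points

variable {k : Type u} [Field k] {a b : k}

theorem exists_rep_pt (a b : k) : ∃ c : k, c ≠ 0 ∧ (pt a b).rep = c • ![a, b, 1] := by
  obtain ⟨c, hc⟩ := Projectivization.exists_smul_eq_mk_rep k ![a, b, 1]
    fun h => one_ne_zero (congrFun h 2)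
  exact ⟨c, c.ne_zero, hc.symm⟩

theorem pt_mem_curve_iff : pt a b ∈ curve k ↔ b ^ 2 = a ^ 3 + a ^ 2 := by
  obtain ⟨c, hc0, hc⟩ := exists_rep_pt a b
  have heval : eval (c • ![a, b, 1]) (cubic k) = c ^ 3 * (a ^ 3 + a ^ 2 - b ^ 2) := by
    simp only [cubic, map_sub, map_add, map_mul, map_pow, eval_X, Pi.smul_apply, smul_eq_mul,
      Matrix.cons_val_zero, Matrix.cons_val_one, Matrix.cons_val]
    ring
  change eval (pt a b).rep (cubic k) = 0 ↔ _
  rw [hc, heval, mul_eq_zero, or_iff_right (pow_ne_zero 3 hc0), sub_eq_zero, eq_comm]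

theorem exists_eval_pderiv_cubic_ne_zero {c : k} (hc : c ≠ 0) (hab : b ^ 2 = a ^ 3 + a ^ 2)
    (h : ¬ (a = 0 ∧ b = 0)) : ∃ i, eval (c • ![a, b, 1]) (pderiv i (cubic k)) ≠ 0 := by
  -- In every characteristic the derivative along `y₃` is nonzero: it is `c² (a² - b²) = - c² a³`.
  refine ⟨2, fun hzero => h ?_⟩
  have hderiv : c ^ 2 * a ^ 2 - c ^ 2 * b ^ 2 = 0 := by
    simpa [cubic, pderiv_X, mul_pow] using hzero
  have hprod : c ^ 2 * a ^ 3 = 0 := by linear_combination -hderiv - c ^ 2 * hab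
  have ha : a = 0 := eq_zero_of_pow_eq_zero ((mul_eq_zero.1 hprod).resolve_left (pow_ne_zero 2 hc))
  exact ⟨ha, by simpa [ha] using hab⟩

theorem pt_ne_pt₀ : pt a b ≠ pt₀ k := by
  rw [pt, pt₀, Ne, Projectivization.mk_eq_mk_iff']
  rintro ⟨c, hc⟩
  simpa using congrFun hc 2

theorem pt_mem_regularLocus (hab : b ^ 2 = a ^ 3 + a ^ 2) (h : ¬ (a = 0 ∧ b = 0)) :
    pt a b ∈ regularLocus k \ {pt₀ k} := by
  obtain ⟨c, hc0, hc⟩ := exists_rep_pt a b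
  refine ⟨⟨pt_mem_curve_iff.2 hab, ?_⟩, pt_ne_pt₀⟩
  rw [hc]
  exact exists_eval_pderiv_cubic_ne_zero hc0 hab h

end Points

section CubicPair

variable {A : Type*} [Ring A] {P Q P' Q' B : A}

/-- The identity `Φ³ + y₃ Φ² = y₂² y₃` for a pencil `Φ = y₂ P + y₃ Q`, dehomogenized by setting
`y₂ = 1` and `y₃ = X`. -/
def IsCubicPair (P Q : A) : Prop :=
  (Polynomial.C P + Polynomial.X * Polynomial.C Q) ^ 3 +
      Polynomial.X * (Polynomial.C P + Polynomial.X * Polynomial.C Q) ^ 2 =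
    (Polynomial.X : Polynomial A)

theorem IsCubicPair.coeff_eq (h : IsCubicPair P Q) :
    P * P * P = 0 ∧ P * P * Q + P * Q * P + Q * P * P + P * P = 1 ∧
      P * Q * Q + Q * P * Q + Q * Q * P + P * Q + Q * P = 0 ∧ Q * Q * Q + Q * Q = 0 := by
  rw [IsCubicPair] at h
  set Φ := Polynomial.C P + Polynomial.X * Polynomial.C Q with hΦ
  have hzero (M : Polynomial A) : (Φ * M).coeff 0 = P * M.coeff 0 := by
    simp [hΦ, add_mul, mul_assoc]
  have hsucc (n : ℕ) (M : Polynomial A) :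
      (Φ * M).coeff n.succ = P * M.coeff n.succ + Q * M.coeff n := by
    simp [hΦ, add_mul, mul_assoc]
  have hX (n : ℕ) (M : Polynomial A) : (Polynomial.X * M).coeff n.succ = M.coeff n :=
    Polynomial.coeff_X_mul M n
  have hΦ0 : Φ.coeff 0 = P := by simp [hΦ]
  have hΦ1 : Φ.coeff 1 = Q := by simp [hΦ]
  have hΦ2 : Φ.coeff 2 = 0 := by simp [hΦ]
  have hΦ3 : Φ.coeff 3 = 0 := by simp [hΦ]
  have hcoeff (n : ℕ) := congrArg (Polynomial.coeff · n) h
  simp only [pow_succ', pow_zero, mul_one, Polynomial.coeff_add, Polynomial.coeff_X] at hcoeff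
  have h0 := hcoeff 0
  have h1 := hcoeff (.succ 0)
  have h2 := hcoeff (.succ (.succ 0))
  have h3 := hcoeff (.succ (.succ (.succ 0)))
  simp only [hzero, hsucc, hX, Polynomial.coeff_X_mul_zero, Nat.reduceSucc, hΦ0, hΦ1, hΦ2, hΦ3,
    mul_zero, zero_add, add_zero, one_ne_zero, OfNat.one_ne_ofNat, ↓reduceIte] at h0 h1 h2 h3
  refine ⟨by rw [← h0, mul_assoc], ?_, ?_, by rw [← h3, mul_assoc]⟩
  · rw [← h1]
    noncomm_ring
  · rw [← h2]
    noncomm_ring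

theorem IsCubicPair.of_semiconjBy (h : IsCubicPair P Q) (hB : IsUnit B) (hP : SemiconjBy B P' P)
    (hQ : SemiconjBy B Q' Q) : IsCubicPair P' Q' := by
  have hX : SemiconjBy (Polynomial.C B) Polynomial.X Polynomial.X :=
    (Polynomial.commute_X _).symm
  have hpencil : SemiconjBy (Polynomial.C B) (Polynomial.C P' + Polynomial.X * Polynomial.C Q')
      (Polynomial.C P + Polynomial.X * Polynomial.C Q) :=
    (hP.map Polynomial.C).add_right (hX.mul_right (hQ.map Polynomial.C))
  have hsum := (hpencil.pow_right 3).add_right (hX.mul_right (hpencil.pow_right 2))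
  rw [h] at hsum
  exact (hB.map Polynomial.C).mul_left_cancel (hsum.trans hX.symm)

end CubicPair

section NormalForm

variable {k : Type u} [Field k] {P Q N : Matrix (Fin 3) (Fin 3) k}

/-- The nilpotent Jordan block of size three. -/
def jordan (k : Type u) [Field k] : Matrix (Fin 3) (Fin 3) k :=
  !![0, 1, 0; 0, 0, 1; 0, 0, 0]

/-- The normal form of the second matrix of a cubic pair whose first matrix is a Jordan block. -/
def normalForm (a b : k) : Matrix (Fin 3) (Fin 3) k :=
  !![0, b, -(a ^ 2 + a); 0, a, -b; 1, 0, -1 - a]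

theorem IsCubicPair.mul_self_ne_zero (h : IsCubicPair P Q) : P * P ≠ 0 := by
  intro h0
  obtain ⟨-, h1, -, -⟩ := h.coeff_eq
  have hP : P = 0 := by
    calc P = P * (P * P * Q + P * Q * P + Q * P * P + P * P) := by rw [h1, mul_one]
      _ = P * P * (P * Q) + P * P * (Q * P) + P * Q * (P * P) + P * P * P := by noncomm_ring
      _ = 0 := by simp only [h0, zero_mul, mul_zero, add_zero]
  simp [hP] at h1

theorem exists_semiconjBy_jordan (h3 : P * P * P = 0) (h2 : P * P ≠ 0) :
    ∃ B, IsUnit B ∧ SemiconjBy B (jordan k) P := by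
  obtain ⟨v, hv⟩ : ∃ v, (P * P).mulVec v ≠ 0 := by
    by_contra! hcon
    refine h2 (Matrix.ext_of_mulVec_single fun i => ?_)
    rw [hcon, Matrix.zero_mulVec]
  have hPv : P.mulVec (P.mulVec v) = (P * P).mulVec v := Matrix.mulVec_mulVec _ _ _
  have hPPv : P.mulVec ((P * P).mulVec v) = 0 := by
    rw [Matrix.mulVec_mulVec, ← mul_assoc, h3, Matrix.zero_mulVec]
  set B : Matrix (Fin 3) (Fin 3) k := (Matrix.of ![(P * P).mulVec v, P.mulVec v, v]).transpose
  have hB (x : Fin 3 → k) : B.mulVec x = x 0 • (P * P).mulVec v + x 1 • P.mulVec v + x 2 • v := by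
    rw [Matrix.mulVec_transpose, Matrix.vecMul_eq_sum, Fin.sum_univ_three]
    rfl
  refine ⟨B, ?_, Matrix.ext_of_mulVec_single fun i => ?_⟩
  · rw [← Matrix.mulVec_injective_iff_isUnit, ← Matrix.coe_mulVecLin, injective_iff_map_eq_zero]
    intro x hx
    rw [Matrix.mulVecLin_apply, hB] at hx
    have hPx := congrArg P.mulVec hx
    simp only [Matrix.mulVec_add, Matrix.mulVec_smul, hPPv, hPv, smul_zero, zero_add,
      Matrix.mulVec_zero] at hPx
    have hPPx := congrArg P.mulVec hPx
    simp only [Matrix.mulVec_add, Matrix.mulVec_smul, hPPv, hPv, smul_zero, zero_add,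
      Matrix.mulVec_zero] at hPPx
    have hx2 : x 2 = 0 := (smul_eq_zero.1 hPPx).resolve_right hv
    rw [hx2, zero_smul, add_zero] at hPx
    have hx1 : x 1 = 0 := (smul_eq_zero.1 hPx).resolve_right hv
    rw [hx1, hx2, zero_smul, zero_smul, add_zero, add_zero] at hx
    have hx0 : x 0 = 0 := (smul_eq_zero.1 hx).resolve_right hv
    exact funext (Fin.forall_fin_succ.2 ⟨hx0, Fin.forall_fin_two.2 ⟨hx1, hx2⟩⟩)
  · rw [← Matrix.mulVec_mulVec, ← Matrix.mulVec_mulVec, hB, hB]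
    simp only [Matrix.mulVec_add, Matrix.mulVec_smul, hPPv, hPv, Matrix.mulVec_single_one]
    fin_cases i <;> simp [jordan]

theorem IsCubicPair.jordan_entries (h : IsCubicPair (jordan k) N) :
    N 2 0 = 1 ∧ N 1 0 + N 2 1 = 0 ∧ N 0 0 + N 1 1 + N 2 2 = -1 := by
  obtain ⟨-, h1, -, -⟩ := h.coeff_eq
  have e00 := congrFun₂ h1 0 0
  have e01 := congrFun₂ h1 0 1
  have e02 := congrFun₂ h1 0 2
  simp only [Matrix.add_apply, Matrix.mul_apply, Fin.sum_univ_three, jordan, Matrix.of_apply,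
    Matrix.cons_val', Matrix.cons_val_zero, Matrix.cons_val_one, Matrix.cons_val,
    Matrix.one_apply_eq, Matrix.one_apply_ne (show (0 : Fin 3) ≠ 1 by decide),
    Matrix.one_apply_ne (show (0 : Fin 3) ≠ 2 by decide)] at e00 e01 e02
  exact ⟨by linear_combination e00, by linear_combination e01, by linear_combination e02⟩

theorem IsCubicPair.eq_normalForm (h : IsCubicPair (jordan k) N) (h00 : N 0 0 = 0)
    (h21 : N 2 1 = 0) :
    N = normalForm (N 1 1) (N 0 1) ∧ N 0 1 ^ 2 = N 1 1 ^ 3 + N 1 1 ^ 2 := by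
  obtain ⟨h20, h10, htr⟩ := h.jordan_entries
  rw [h21, add_zero] at h10
  have h22 : N 2 2 = -1 - N 1 1 := by linear_combination htr - h00
  obtain ⟨-, -, h2, h3⟩ := h.coeff_eq
  have e00 := congrFun₂ h2 0 0
  have e01 := congrFun₂ h2 0 1
  have e22 := congrFun₂ h3 2 2
  simp only [Matrix.add_apply, Matrix.mul_apply, Fin.sum_univ_three, jordan, Matrix.of_apply,
    Matrix.cons_val', Matrix.cons_val_zero, Matrix.cons_val_one, Matrix.cons_val,
    Matrix.zero_apply, h00, h21, h20, h10, h22] at e00 e01 e22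
  have h12 : N 1 2 = -N 0 1 := by linear_combination e00
  have h02 : N 0 2 = -(N 1 1 ^ 2 + N 1 1) := by linear_combination e01
  rw [h12, h02] at e22
  refine ⟨?_, by linear_combination -e22⟩
  nth_rewrite 1 [Matrix.eta_fin_three N]
  rw [h00, h02, h10, h12, h20, h21, h22, normalForm]

theorem IsCubicPair.exists_normalForm_of_jordan (h : IsCubicPair (jordan k) Q) :
    ∃ (B : Matrix (Fin 3) (Fin 3) k) (a b : k), IsUnit B ∧ SemiconjBy B (jordan k) (jordan k) ∧
      SemiconjBy B (normalForm a b) Q ∧ b ^ 2 = a ^ 3 + a ^ 2 := by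
  obtain ⟨h20, h10, -⟩ := h.jordan_entries
  generalize hc : Q 1 0 = c at h10
  generalize hd : Q 0 0 = d
  -- The centralizer of the Jordan block: `B = 1 + c J + d J²`, with `c`, `d` chosen to clear the
  -- entries `(2, 1)` and `(0, 0)`.
  set B : Matrix (Fin 3) (Fin 3) k := !![1, c, d; 0, 1, c; 0, 0, 1]
  set B' : Matrix (Fin 3) (Fin 3) k := !![1, -c, c ^ 2 - d; 0, 1, -c; 0, 0, 1]
  have hBB' : B * B' = 1 := by
    rw [Matrix.one_fin_three, Matrix.mul_fin_three]
    ring_nf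
  have hB : IsUnit B := IsUnit.of_mul_eq_one _ hBB'
  have hJ : SemiconjBy B (jordan k) (jordan k) := by
    rw [SemiconjBy, jordan, Matrix.mul_fin_three, Matrix.mul_fin_three]
    ring_nf
  have hQ : SemiconjBy B (B' * Q * B) Q := by
    rw [SemiconjBy, ← mul_assoc, ← mul_assoc, hBB', one_mul]
  have h00 : (B' * Q * B) 0 0 = 0 := by
    simp only [B, B', Matrix.mul_apply, Fin.sum_univ_three, Matrix.of_apply, Matrix.cons_val',
      Matrix.cons_val_zero, Matrix.cons_val_one, Matrix.cons_val, h20, hc, hd]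
    ring
  have h21 : (B' * Q * B) 2 1 = 0 := by
    simp only [B, B', Matrix.mul_apply, Fin.sum_univ_three, Matrix.of_apply, Matrix.cons_val',
      Matrix.cons_val_zero, Matrix.cons_val_one, Matrix.cons_val, h20, hc, hd]
    linear_combination h10
  obtain ⟨hN, hab⟩ := (h.of_semiconjBy hB hJ hQ).eq_normalForm h00 h21
  exact ⟨B, _, _, hB, hJ, hN ▸ hQ, hab⟩

theorem IsCubicPair.exists_normalForm (h : IsCubicPair P Q) :
    ∃ (B : Matrix (Fin 3) (Fin 3) k) (a b : k), IsUnit B ∧ SemiconjBy B (jordan k) P ∧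
      SemiconjBy B (normalForm a b) Q ∧ b ^ 2 = a ^ 3 + a ^ 2 := by
  obtain ⟨B, hB, hP⟩ := exists_semiconjBy_jordan h.coeff_eq.1 h.mul_self_ne_zero
  have hQ : SemiconjBy B (B⁻¹ * Q * B) Q := by
    rw [SemiconjBy, ← mul_assoc, ← mul_assoc,
      Matrix.mul_nonsing_inv _ ((Matrix.isUnit_iff_isUnit_det B).1 hB), one_mul]
  obtain ⟨D, a, b, hD, hJD, hND, hab⟩ := (h.of_semiconjBy hB hP hQ).exists_normalForm_of_jordan
  exact ⟨B * D, a, b, hB.mul hD, hP.mul_left hJD, hQ.mul_left hND, hab⟩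

end NormalForm

section GradedGroup

variable {ι M : Type*} [DecidableEq ι] [AddCommGroup M] {𝓜 : ι → AddSubgroup M}

/-- The projection of an internally graded group onto its component of degree `d`, viewed as an
endomorphism of the group. -/
def gradeProj (h : DirectSum.IsInternal 𝓜) (d : ι) : M →+ M :=
  (𝓜 d).subtype.comp ((DFinsupp.evalAddMonoidHom d).comp
    (AddEquiv.ofBijective (DirectSum.coeAddMonoidHom 𝓜) h).symm.toAddMonoidHom)

theorem gradeProj_mem (h : DirectSum.IsInternal 𝓜) (d : ι) (m : M) : gradeProj h d m ∈ 𝓜 d :=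
  Subtype.property _

theorem gradeProj_of_mem (h : DirectSum.IsInternal 𝓜) {e : ι} {m : M} (hm : m ∈ 𝓜 e) (d : ι) :
    gradeProj h d m = if d = e then m else 0 := by
  have hsymm : (AddEquiv.ofBijective (DirectSum.coeAddMonoidHom 𝓜) h).symm m =
      DirectSum.of (fun i => 𝓜 i) e ⟨m, hm⟩ := by
    rw [AddEquiv.symm_apply_eq]
    exact (DirectSum.coeAddMonoidHom_of 𝓜 e ⟨m, hm⟩).symm
  change ((((AddEquiv.ofBijective (DirectSum.coeAddMonoidHom 𝓜) h).symm m) d : 𝓜 d) : M) = _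
  rw [hsymm, DirectSum.coe_of_apply]
  rcases eq_or_ne e d with rfl | hne
  · simp
  · simp [hne, hne.symm]

theorem graded_induction (h : DirectSum.IsInternal 𝓜) {p : M → Prop} (zero : p 0)
    (add : ∀ x y, p x → p y → p (x + y)) (hom : ∀ d, ∀ x ∈ 𝓜 d, p x) (m : M) : p m := by
  obtain ⟨x, rfl⟩ := h.surjective m
  induction x using DirectSum.induction_on with
  | zero => rwa [map_zero]
  | of d x => rw [DirectSum.coeAddMonoidHom_of]; exact hom d x x.2
  | add x y hx hy => rw [map_add]; exact add _ _ hx hy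

theorem eq_zero_of_gradeProj (h : DirectSum.IsInternal 𝓜) {m : M}
    (hm : ∀ d, gradeProj h d m = 0) : m = 0 := by
  rw [← map_zero (AddEquiv.ofBijective (DirectSum.coeAddMonoidHom 𝓜) h),
    ← AddEquiv.symm_apply_eq]
  exact DFinsupp.ext fun d => Subtype.ext (hm d)

variable {κ N : Type*} [DecidableEq κ] [AddCommGroup N] {𝓝 : κ → AddSubgroup N} {f : ι → κ}

theorem gradeProj_map (hM : DirectSum.IsInternal 𝓜) (hN : DirectSum.IsInternal 𝓝)
    (hf : Function.Injective f) (φ : M →+ N) (hφ : ∀ i, ∀ x ∈ 𝓜 i, φ x ∈ 𝓝 (f i)) (i : ι) (x : M) :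
    gradeProj hN (f i) (φ x) = φ (gradeProj hM i x) := by
  induction x using graded_induction hM with
  | zero => simp
  | add x y hx hy => simp [hx, hy]
  | hom j x hx =>
    rw [gradeProj_of_mem hM hx, gradeProj_of_mem hN (hφ j x hx)]
    rcases eq_or_ne i j with rfl | hij
    · simp
    · simp [hij, hf.ne hij]

theorem mem_iff_map_mem (hM : DirectSum.IsInternal 𝓜) (hN : DirectSum.IsInternal 𝓝)
    (hf : Function.Injective f) {φ : M →+ N} (hφ : Function.Injective φ)
    (hmem : ∀ i, ∀ x ∈ 𝓜 i, φ x ∈ 𝓝 (f i)) (i : ι) (x : M) : x ∈ 𝓜 i ↔ φ x ∈ 𝓝 (f i) := by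
  refine ⟨hmem i x, fun hx => ?_⟩
  have hproj := gradeProj_map hM hN hf φ hmem i x
  rw [gradeProj_of_mem hN hx, if_pos rfl] at hproj
  rw [hφ hproj]
  exact gradeProj_mem hM i x

end GradedGroup

section PolynomialGraded

variable {σ A M : Type*} [CommRing A] [AddCommGroup M] [Module (MvPolynomial σ A) M]

/-- `𝓜` is a `ℤ`-grading of the module `M` over a polynomial ring with its standard grading. -/
structure IsPolynomialGraded (σ A : Type*) [CommRing A] {M : Type*} [AddCommGroup M]
    [Module (MvPolynomial σ A) M] (𝓜 : ℤ → AddSubgroup M) : Prop where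
  isInternal : DirectSum.IsInternal 𝓜
  smul_mem {n : ℕ} {p : MvPolynomial σ A} (hp : p.IsHomogeneous n) {e : ℤ} {m : M}
    (hm : m ∈ 𝓜 e) : p • m ∈ 𝓜 (n + e)

namespace IsPolynomialGraded

variable {𝓜 : ℤ → AddSubgroup M} (h : IsPolynomialGraded σ A 𝓜)

include h

theorem gradeProj_smul (a : MvPolynomial σ A) {e : ℤ} {m : M} (hm : m ∈ 𝓜 e) (d : ℤ) :
    gradeProj h.isInternal d (a • m) = intComponent (d - e) a • m := by
  conv_lhs => rw [← sum_intComponent a, Finset.sum_smul, map_sum]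
  conv_rhs => rw [← sum_intComponent a, map_sum, Finset.sum_smul]
  refine Finset.sum_congr rfl fun i _ => ?_
  have hmem : intComponent (i : ℤ) a • m ∈ 𝓜 (i + e) := by
    rw [intComponent_natCast]
    exact h.smul_mem (homogeneousComponent_isHomogeneous i a) hm
  rw [gradeProj_of_mem h.isInternal hmem, intComponent_intComponent]
  by_cases hd : d = i + e
  · rw [if_pos hd, if_pos (by omega)]
  · rw [if_neg hd, if_neg (by omega), zero_smul]

theorem gradeProj_smul_of_isHomogeneous {n : ℕ} {p : MvPolynomial σ A} (hp : p.IsHomogeneous n)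
    (d : ℤ) (m : M) :
    gradeProj h.isInternal (n + d) (p • m) = p • gradeProj h.isInternal d m :=
  gradeProj_map h.isInternal h.isInternal (add_right_injective (n : ℤ))
    (DistribSMul.toAddMonoidHom M p) (fun _ _ hx => h.smul_mem hp hx) d m

theorem gradeProj_X_smul (i : σ) (d : ℤ) (m : M) :
    gradeProj h.isInternal d ((X i : MvPolynomial σ A) • m) =
      (X i : MvPolynomial σ A) • gradeProj h.isInternal (d - 1) m := by
  rw [← gradeProj_smul_of_isHomogeneous h (isHomogeneous_X A i), Nat.cast_one, add_sub_cancel]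

theorem gradeProj_mem_span {s : Set M} (hs : ∀ x ∈ s, ∃ d, x ∈ 𝓜 d) {x : M}
    (hx : x ∈ Submodule.span (MvPolynomial σ A) s) (d : ℤ) :
    gradeProj h.isInternal d x ∈ Submodule.span (MvPolynomial σ A) s := by
  rw [Submodule.mem_span_set'] at hx
  obtain ⟨n, a, m, rfl⟩ := hx
  rw [map_sum]
  refine sum_mem fun i _ => ?_
  obtain ⟨e, he⟩ := hs _ (m i).2
  rw [h.gradeProj_smul (a i) he]
  exact Submodule.smul_mem _ _ (Submodule.subset_span (m i).2)

theorem exists_finset_span_eq_top [Module.Finite (MvPolynomial σ A) M] :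
    ∃ s : Finset M, (∀ x ∈ s, ∃ d, x ∈ 𝓜 d) ∧
      Submodule.span (MvPolynomial σ A) (s : Set M) = ⊤ := by
  have htop : Submodule.span (MvPolynomial σ A) {x | ∃ d, x ∈ 𝓜 d} = ⊤ := by
    refine eq_top_iff.2 fun x _ => ?_
    induction x using graded_induction h.isInternal with
    | zero => exact zero_mem _
    | add x y hx hy => exact add_mem (hx trivial) (hy trivial)
    | hom d x hx => exact Submodule.subset_span ⟨d, hx⟩
  obtain ⟨s, hs, hspan⟩ := (Submodule.fg_span_iff_fg_span_finset_subset _).1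
    (htop ▸ Module.Finite.fg_top)
  exact ⟨s, fun _ hx => hs hx, hspan ▸ htop⟩

theorem exists_forall_lt_eq_bot [Module.Finite (MvPolynomial σ A) M] :
    ∃ l : ℤ, ∀ d < l, 𝓜 d = ⊥ := by
  obtain ⟨s, hs, hspan⟩ := h.exists_finset_span_eq_top
  choose! e he using hs
  obtain ⟨l, hl⟩ := (s.finite_toSet.image e).bddBelow
  refine ⟨l, fun d hd => (AddSubgroup.eq_bot_iff_forall _).2 fun x hx => ?_⟩
  obtain ⟨n, a, m, hsum⟩ := Submodule.mem_span_set'.1 (hspan ▸ Submodule.mem_top (x := x))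
  have hproj := gradeProj_of_mem h.isInternal hx d
  rw [if_pos rfl, ← hsum, map_sum] at hproj
  rw [← hsum, ← hproj]
  refine Finset.sum_eq_zero fun i _ => ?_
  have hle : l ≤ e (m i) := hl ⟨m i, (m i).2, rfl⟩
  rw [h.gradeProj_smul _ (he _ (m i).2), intComponent_of_neg (by omega), zero_smul]

theorem gradeProj_mem_of_forall_mem {N : Submodule (MvPolynomial σ A) M} {d : ℤ}
    (hN : ∀ x ∈ 𝓜 (d - 1), x ∈ N) {x : M}
    (hx : x ∈ idealOfVars σ A • (⊤ : Submodule (MvPolynomial σ A) M)) :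
    gradeProj h.isInternal d x ∈ N := by
  induction hx using Submodule.smul_induction_on' with
  | add x _ y _ hx hy => rw [map_add]; exact add_mem hx hy
  | smul p hp m _ =>
    induction hp using Submodule.span_induction generalizing m with
    | mem _ hp =>
      obtain ⟨i, rfl⟩ := hp
      rw [h.gradeProj_X_smul]
      exact N.smul_mem _ (hN _ (gradeProj_mem _ _ _))
    | zero => rw [zero_smul, map_zero]; exact zero_mem _
    | add p q _ _ hp hq => rw [add_smul, map_add]; exact add_mem (hp m trivial) (hq m trivial)
    | smul c p _ hp => rw [smul_eq_mul, mul_comm, mul_smul]; exact hp (c • m) trivial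

/-- The graded Nakayama lemma. -/
theorem span_eq_top_of_sup_eq_top [Module.Finite (MvPolynomial σ A) M] {s : Set M}
    (hs : ∀ x ∈ s, ∃ d, x ∈ 𝓜 d)
    (hsup : Submodule.span (MvPolynomial σ A) s ⊔ idealOfVars σ A • ⊤ = ⊤) :
    Submodule.span (MvPolynomial σ A) s = ⊤ := by
  obtain ⟨l, hl⟩ := h.exists_forall_lt_eq_bot
  have hcomponent (d : ℤ) (hd : l - 1 ≤ d) :
      ∀ x ∈ 𝓜 d, x ∈ Submodule.span (MvPolynomial σ A) s := by
    induction d, hd using Int.leInduction with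
    | base => simp [hl (l - 1) (by omega)]
    | succ d _ ih =>
      intro x hx
      obtain ⟨z, hz, w, hw, hzw⟩ := Submodule.mem_sup.1 (hsup ▸ Submodule.mem_top (x := x))
      have hproj := gradeProj_of_mem h.isInternal hx (d + 1)
      rw [if_pos rfl, ← hzw, map_add] at hproj
      rw [← hzw, ← hproj]
      exact add_mem (h.gradeProj_mem_span hs hz _)
        (h.gradeProj_mem_of_forall_mem (by rwa [add_sub_cancel_right]) hw)
  refine eq_top_iff.2 fun x _ => ?_
  induction x using graded_induction h.isInternal with
  | zero => exact zero_mem _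
  | add x y hx hy => exact add_mem (hx trivial) (hy trivial)
  | hom d x hx =>
    rcases lt_or_ge d l with hd | hd
    · rw [(AddSubgroup.eq_bot_iff_forall _).1 (hl d hd) x hx]
      exact zero_mem _
    · exact hcomponent d (by omega) x hx

end IsPolynomialGraded

end PolynomialGraded

section LinearIndependence

variable {A M ι : Type*} [CommRing A] [IsNoetherianRing A] [AddCommGroup M] [Module A M]
  [Fintype ι] {m : ι → M}

/-- The hypothesis `hm` allows one to divide a relation by `x` modulo `I`; iterating, the
coefficients lie in `(xⁿ) + I` for all `n`, and Krull's intersection theorem in `A / I` applies. -/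
theorem mem_of_sum_smul_mem {I : Ideal A} [I.IsPrime] {x : A} (hx : Ideal.span {x} ⊔ I ≠ ⊤)
    {N : Submodule A M} (hIN : I • ⊤ ≤ N) (hreg : ∀ m, x • m ∈ N → m ∈ N)
    (hm : ∀ a : ι → A, ∑ i, a i • m i ∈ N → ∀ i, a i ∈ Ideal.span {x} ⊔ I) {a : ι → A}
    (ha : ∑ i, a i • m i ∈ N) (i : ι) : a i ∈ I := by
  have hdivide (n : ℕ) : ∃ b : ι → A, (∀ i, a i - x ^ n * b i ∈ I) ∧ ∑ i, b i • m i ∈ N := by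
    induction n with
    | zero => exact ⟨a, by simp, ha⟩
    | succ n ih =>
      obtain ⟨b, hab, hb⟩ := ih
      choose c d hd hbcd using fun i => Ideal.mem_span_singleton_sup.1 (hm b hb i)
      refine ⟨c, fun i => ?_, hreg _ ?_⟩
      · have hsplit : a i - x ^ (n + 1) * c i = (a i - x ^ n * b i) + x ^ n * d i := by
          rw [← hbcd]
          ring
        exact hsplit ▸ add_mem (hab i) (I.mul_mem_left _ (hd i))
      · have hsplit : x • ∑ i, c i • m i = ∑ i, b i • m i - ∑ i, d i • m i := by
          simp only [← hbcd, Finset.smul_sum, ← Finset.sum_sub_distrib, add_smul, smul_smul,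
            mul_comm x, add_sub_cancel_right]
        exact hsplit ▸ sub_mem hb
          (sum_mem fun i _ => hIN (Submodule.smul_mem_smul (hd i) Submodule.mem_top))
  have hne : Ideal.span {Ideal.Quotient.mk I x} ≠ ⊤ := fun htop => hx <| by
    rw [← I.mk_ker, ← Ideal.comap_map_of_surjective' _ Ideal.Quotient.mk_surjective,
      Ideal.map_span, Set.image_singleton, htop, Ideal.comap_top]
  rw [← Ideal.Quotient.eq_zero_iff_mem, ← Ideal.mem_bot, ← Ideal.iInf_pow_eq_bot_of_isDomain _ hne,
    Ideal.mem_iInf]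
  intro n
  obtain ⟨b, hab, -⟩ := hdivide n
  rw [Ideal.span_singleton_pow, Ideal.mem_span_singleton, ← map_pow, Ideal.Quotient.eq.2 (hab i),
    map_mul]
  exact dvd_mul_right _ _

theorem linearIndependent_of_isWeaklyRegular [IsDomain A] {r s : A} (hr : Prime r)
    (hrs : Ideal.span {s, r} ≠ ⊤) (hreg : RingTheory.Sequence.IsWeaklyRegular M [r, s])
    (hm : ∀ a : ι → A, ∑ i, a i • m i ∈ Ideal.span {s, r} • (⊤ : Submodule A M) →
      ∀ i, a i ∈ Ideal.span {s, r}) : LinearIndependent A m := by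
  obtain ⟨hregr, hregs⟩ := (isWeaklyRegular_pair_iff r s).1 hreg
  have : (Ideal.span {r}).IsPrime := (Ideal.span_singleton_prime hr.ne_zero).2 hr
  have hmodr (a : ι → A) : ∑ i, a i • m i ∈ Ideal.span {r} • (⊤ : Submodule A M) →
      ∀ i, a i ∈ Ideal.span {r} := by
    refine mem_of_sum_smul_mem (x := s) ?_ le_rfl (fun u hu => ?_) fun a ha => ?_
    · rwa [← Ideal.span_insert]
    · rw [Submodule.ideal_span_singleton_smul, Submodule.mem_smul_pointwise_iff_exists] at hu ⊢
      obtain ⟨v, -, hv⟩ := hu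
      obtain ⟨w, hw⟩ := hregs u v hv.symm
      exact ⟨w, Submodule.mem_top, hw.symm⟩
    · rw [← Ideal.span_insert]
      exact hm a (Submodule.smul_mono_left (Ideal.span_mono (by simp)) ha)
  rw [Fintype.linearIndependent_iff]
  intro a ha i
  refine (Submodule.mem_bot A).1 (mem_of_sum_smul_mem (m := m) (I := ⊥) (x := r) (N := ⊥)
    ?_ (Submodule.bot_smul _).le (fun u hu => ?_) (fun b hb => ?_) ((Submodule.mem_bot A).2 ha) i)
  · rw [sup_bot_eq]
    exact Ideal.IsPrime.ne_top'
  · exact hregr (hu.trans (smul_zero r).symm)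
  · rw [sup_bot_eq]
    exact hmodr b (hb.symm ▸ zero_mem _)

end LinearIndependence

section HomogeneousBasis

variable {σ k M : Type*} [Field k] [AddCommGroup M]

theorem idealOfVars_eq_ker (σ R : Type*) [CommRing R] :
    idealOfVars σ R = RingHom.ker (constantCoeff : MvPolynomial σ R →+* R) := by
  ext p
  rw [← pow_one (idealOfVars σ R), mem_pow_idealOfVars_iff', RingHom.mem_ker]
  simp [constantCoeff_eq, Finsupp.degree_eq_zero_iff]

instance instIsMaximalIdealOfVars : (idealOfVars σ k).IsMaximal :=
  idealOfVars_eq_ker σ k ▸ RingHom.ker_isMaximal_of_surjective _ fun c => ⟨C c, by simp⟩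

variable [Module (MvPolynomial σ k) M] {𝓜 : ℤ → AddSubgroup M}

theorem IsPolynomialGraded.exists_minimal_generators [Module.Finite (MvPolynomial σ k) M]
    (h : IsPolynomialGraded σ k 𝓜) :
    ∃ s : Finset M, (∀ x ∈ s, ∃ d, x ∈ 𝓜 d) ∧
      Submodule.span (MvPolynomial σ k) (s : Set M) = ⊤ ∧
      ∀ a : s → MvPolynomial σ k,
        ∑ x, a x • (x : M) ∈ idealOfVars σ k • (⊤ : Submodule (MvPolynomial σ k) M) →
          ∀ x, a x ∈ idealOfVars σ k := by
  let I := idealOfVars σ k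
  let _ : Field (MvPolynomial σ k ⧸ I) := Ideal.Quotient.field I
  let π := (I • (⊤ : Submodule (MvPolynomial σ k) M)).mkQ
  obtain ⟨t, ht, hspan⟩ := h.exists_finset_span_eq_top
  obtain ⟨s, hst, -, hspans, hs⟩ := exists_linearIndepOn_extension
    (linearIndepOn_empty (MvPolynomial σ k ⧸ I) π) (Set.empty_subset (t : Set M))
  lift s to Finset M using t.finite_toSet.subset hst
  refine ⟨s, fun x hx => ht x (hst hx), h.span_eq_top_of_sup_eq_top (fun x hx => ht x (hst hx)) ?_,
    fun a ha => ?_⟩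
  · have htop : Submodule.span (MvPolynomial σ k) (π '' t) = ⊤ := by
      rw [← Submodule.map_span, hspan, Submodule.map_top, Submodule.range_mkQ]
    rw [sup_comm, ← Submodule.map_mkQ_eq_top, Submodule.map_span, eq_top_iff, ← htop,
      Submodule.span_le, ← Submodule.restrictScalars_span _ (MvPolynomial σ k ⧸ I)
        Ideal.Quotient.mk_surjective]
    exact hspans
  · have hzero : ∑ x, Ideal.Quotient.mk I (a x) • π x = 0 := by
      rw [← (Submodule.Quotient.mk_eq_zero _).2 ha]
      exact (map_sum π _ _).symm
    exact fun x => Ideal.Quotient.eq_zero_iff_mem.1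
      (Fintype.linearIndependent_iff.1 hs.linearIndependent _ hzero x)

theorem span_X_pair_eq_idealOfVars (k : Type*) [Field k] :
    Ideal.span {X 0, X 1} = idealOfVars (Fin 2) k := by
  rw [idealOfVars]
  congr 1
  ext p
  simp [eq_comm]

theorem IsPolynomialGraded.exists_homogeneous_basis [Module (MvPolynomial (Fin 2) k) M]
    [Module.Finite (MvPolynomial (Fin 2) k) M] {𝓜 : ℤ → AddSubgroup M}
    (h : IsPolynomialGraded (Fin 2) k 𝓜)
    (hreg : RingTheory.Sequence.IsWeaklyRegular M [(X 1 : MvPolynomial (Fin 2) k), X 0]) :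
    ∃ (n : ℕ) (b : Module.Basis (Fin n) (MvPolynomial (Fin 2) k) M) (e : Fin n → ℤ),
      ∀ i, b i ∈ 𝓜 (e i) := by
  obtain ⟨s, hs, hspan, hmin⟩ := h.exists_minimal_generators
  have hli : LinearIndependent (MvPolynomial (Fin 2) k) ((↑) : s → M) := by
    rw [← span_X_pair_eq_idealOfVars] at hmin
    refine linearIndependent_of_isWeaklyRegular X_prime ?_ hreg hmin
    rw [span_X_pair_eq_idealOfVars]
    exact Ideal.IsMaximal.ne_top inferInstance
  let b := Module.Basis.mk hli (by rw [Subtype.range_coe_subtype]; exact hspan.ge)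
  choose e he using fun i => hs _ (s.equivFin.symm i).2
  refine ⟨s.card, b.reindex s.equivFin, e, fun i => ?_⟩
  rw [Module.Basis.reindex_apply, Module.Basis.mk_apply]
  exact he i

end HomogeneousBasis

section Koszul

variable {R M ι : Type*} [CommRing R] [AddCommGroup M] [Module R M] [Finite ι] {x : ι → R}
  {r s : R}

/-- The vanishing of the first Koszul cohomology of a module of depth at least two. -/
theorem exists_forall_eq_smul_of_cocycle (hr : r ∈ Ideal.span (Set.range x))
    (hs : s ∈ Ideal.span (Set.range x)) (hreg : RingTheory.Sequence.IsWeaklyRegular M [r, s])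
    {m : ι → M} (hm : ∀ i j, x i • m j = x j • m i) : ∃ w, ∀ i, m i = x i • w := by
  cases nonempty_fintype ι
  obtain ⟨hregr, hregs⟩ := (isWeaklyRegular_pair_iff r s).1 hreg
  obtain ⟨a, rfl⟩ := Ideal.mem_span_range_iff_exists_fun.1 hr
  obtain ⟨b, rfl⟩ := Ideal.mem_span_range_iff_exists_fun.1 hs
  have hswap (c : ι → R) (j : ι) : x j • ∑ i, c i • m i = (∑ i, c i * x i) • m j := by
    rw [Finset.smul_sum, Finset.sum_smul]
    refine Finset.sum_congr rfl fun i _ => ?_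
    rw [smul_comm, ← hm i j, mul_smul]
  obtain ⟨w, hw⟩ := hregs (∑ i, a i • m i) (∑ i, b i • m i) (by
    rw [Finset.sum_smul, Finset.smul_sum]
    refine Finset.sum_congr rfl fun j _ => ?_
    rw [mul_smul, hswap, smul_comm])
  refine ⟨w, fun j => hregr ?_⟩
  change (∑ i, a i * x i) • m j = (∑ i, a i * x i) • x j • w
  rw [← hswap, hw, smul_comm]

theorem mem_of_pow_smul_mem {x : R} {K N : Submodule R M}
    (h : ∀ m ∈ K, x • m ∈ N → m ∈ N) (n : ℕ) {m : M} (hm : m ∈ K) (hxm : x ^ n • m ∈ N) :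
    m ∈ N := by
  induction n with
  | zero => rwa [pow_zero, one_smul] at hxm
  | succ n ih =>
    rw [pow_succ', mul_smul] at hxm
    exact ih (h _ (K.smul_mem _ hm) hxm)

end Koszul

section Depth

variable {k : Type u} [Field k] {M : Type v} [AddCommGroup M] [Module (NodeRing k) M]
  {𝓜 : ℤ → AddSubgroup M}

theorem IsGraded.gradeProj_X_smul (h : IsGraded (k := k) 𝓜) (i : Fin 3) (d : ℤ) (m : M) :
    gradeProj h.1 (1 + d) (quot k (X i) • m) = quot k (X i) • gradeProj h.1 d m :=
  gradeProj_map h.1 h.1 (add_right_injective 1) (DistribSMul.toAddMonoidHom M (quot k (X i)))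
    (fun e _ hx => h.2 1 e _ _ (quot_mem_ringDeg (isHomogeneous_X k i)) hx) d m

theorem IsGraded.isPolynomialGraded [Module (MvPolynomial (Fin 2) k) M]
    [IsScalarTower (MvPolynomial (Fin 2) k) (NodeRing k) M] (h : IsGraded (k := k) 𝓜) :
    IsPolynomialGraded (Fin 2) k 𝓜 where
  isInternal := h.1
  smul_mem {n p} hp {e m} hm := by
    rw [← algebraMap_smul (NodeRing k) p m, algebraMap_eq]
    exact h.2 n e _ m (quot_mem_ringDeg hp.rename_isHomogeneous) hm

/-- On the elements killed by `y₁` and `y₃` the Koszul cocycle `(0, n, 0)` makes every element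
divisible by `y₂` within that set, which a grading bounded below does not allow. -/
theorem IsGraded.eq_zero_of_smul_eq_zero (h : IsGraded (k := k) 𝓜)
    (hbdd : ∃ l : ℤ, ∀ d < l, 𝓜 d = ⊥) {r s : NodeRing k} (hr : r ∈ irrelevant k)
    (hs : s ∈ irrelevant k) (hreg : RingTheory.Sequence.IsWeaklyRegular M [r, s]) {n : M}
    (h₀ : quot k (X 0) • n = 0) (h₂ : quot k (X 2) • n = 0) : n = 0 := by
  obtain ⟨l, hl⟩ := hbdd
  have hbelow (d : ℤ) (hd : d < l) (n : M) : gradeProj h.1 d n = 0 :=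
    (AddSubgroup.eq_bot_iff_forall _).1 (hl d hd) _ (gradeProj_mem h.1 d n)
  have hcomponent (d : ℤ) (hd : l - 1 ≤ d) (n : M) (h₀ : quot k (X 0) • n = 0)
      (h₂ : quot k (X 2) • n = 0) : gradeProj h.1 d n = 0 := by
    induction d, hd using Int.leInduction generalizing n with
    | base => exact hbelow _ (by omega) n
    | succ d _ ih =>
      obtain ⟨w, hw⟩ := exists_forall_eq_smul_of_cocycle hr hs hreg (m := ![0, n, 0]) (by
        intro i j
        fin_cases i <;> fin_cases j <;> simp [h₀, h₂])
      have hn : n = quot k (X 1) • w := hw 1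
      rw [hn, add_comm, h.gradeProj_X_smul, ih w (hw 0).symm (hw 2).symm, smul_zero]
  refine eq_zero_of_gradeProj h.1 fun d => ?_
  rcases lt_or_ge d l with hd | hd
  · exact hbelow d hd n
  · exact hcomponent d (by omega) n h₀ h₂

theorem quot_X_zero_pow_three (k : Type u) [Field k] :
    quot k (X 0) ^ 3 = quot k (X 2) * quot k (X 1 ^ 2 - X 0 ^ 2) := by
  rw [← map_pow, ← map_mul, ← sub_eq_zero, ← map_sub]
  refine (congrArg (quot k) ?_).trans (quot_cubic k)
  rw [cubic]
  ring

/-- The element `y₁` is nilpotent modulo `y₃`, so that its action can be cancelled both on the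
kernel of `y₃` and modulo `y₃`. -/
theorem IsGraded.isWeaklyRegular_of_isWeaklyRegular (h : IsGraded (k := k) 𝓜)
    (hbdd : ∃ l : ℤ, ∀ d < l, 𝓜 d = ⊥) {r s : NodeRing k} (hr : r ∈ irrelevant k)
    (hs : s ∈ irrelevant k) (hreg : RingTheory.Sequence.IsWeaklyRegular M [r, s]) :
    RingTheory.Sequence.IsWeaklyRegular M [quot k (X 2), quot k (X 1)] := by
  have hinj : IsSMulRegular M (quot k (X 2)) := by
    rw [isSMulRegular_iff_right_eq_zero_of_smul]
    intro m hm
    refine (Submodule.mem_bot (NodeRing k)).1 (mem_of_pow_smul_mem (x := quot k (X 0))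
      (K := LinearMap.ker (LinearMap.lsmul (NodeRing k) M (quot k (X 2)))) ?_ 3 hm ?_)
    · exact fun n h₂ h₀ => h.eq_zero_of_smul_eq_zero hbdd hr hs hreg h₀ h₂
    · rw [quot_X_zero_pow_three, mul_comm, mul_smul, hm, smul_zero]
      exact zero_mem _
  rw [isWeaklyRegular_pair_iff]
  refine ⟨hinj, fun m m' hm => ?_⟩
  let N := LinearMap.range (LinearMap.lsmul (NodeRing k) M (quot k (X 2)))
  obtain ⟨w, hw⟩ : m ∈ N := by
    refine mem_of_pow_smul_mem (x := quot k (X 0))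
      (K := N.comap (LinearMap.lsmul (NodeRing k) M (quot k (X 1)))) ?_ 3 ⟨m', hm.symm⟩ ?_
    · rintro n ⟨w₁, h₁ : quot k (X 2) • w₁ = quot k (X 1) • n⟩
        ⟨w₀, h₀ : quot k (X 2) • w₀ = quot k (X 0) • n⟩
      have h₀₁ : quot k (X 0) • w₁ = quot k (X 1) • w₀ := hinj <| by
        simp only [smul_comm (quot k (X 2)), h₀, h₁]
        exact smul_comm _ _ _
      obtain ⟨w, hw⟩ := exists_forall_eq_smul_of_cocycle hr hs hreg (m := ![w₀, w₁, n]) (by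
        intro i j
        fin_cases i <;> fin_cases j <;> simp [h₀, h₁, h₀₁])
      exact ⟨w, (hw 2).symm⟩
    · rw [quot_X_zero_pow_three, mul_smul]
      exact ⟨_, rfl⟩
  exact ⟨w, hw.symm⟩

end Depth

section Rank

variable (A R M : Type*) [CommRing A] [CommRing R] [IsDomain R] [Algebra A R]
  [Algebra.IsAlgebraic A R] [AddCommGroup M] [Module R M] [Module A M] [IsScalarTower A R M]

theorem isTorsionFree_of_isAlgebraic [IsDomain A] [Module.IsTorsionFree A M] :
    Module.IsTorsionFree R M := by
  refine .of_smul_eq_zero fun r m hrm => or_iff_not_imp_left.2 fun hr => ?_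
  obtain ⟨a, ha, s, hs⟩ :=
    (Algebra.IsAlgebraic.isAlgebraic (R := A) r).exists_nonzero_dvd
      (mem_nonZeroDivisors_of_ne_zero hr)
  refine (smul_eq_zero_iff_right ha).1 ?_
  rw [← algebraMap_smul R a m, hs, mul_comm, mul_smul, hrm, smul_zero]

theorem rank_eq_zero_of_isAlgebraic (h : Module.rank R M = 0) : Module.rank A M = 0 := by
  rw [rank_eq_zero_iff] at h ⊢
  intro m
  obtain ⟨r, hr, hrm⟩ := h m
  obtain ⟨a, ha, s, hs⟩ :=
    (Algebra.IsAlgebraic.isAlgebraic (R := A) r).exists_nonzero_dvd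
      (mem_nonZeroDivisors_of_ne_zero hr)
  exact ⟨a, ha, by rw [← algebraMap_smul R a m, hs, mul_comm, mul_smul, hrm, smul_zero]⟩

theorem finrank_eq_finrank_of_rank_eq_one [IsDomain A] (h : Module.rank R M = 1) :
    Module.finrank A M = Module.finrank A R := by
  obtain ⟨φ, hφ⟩ := Module.one_le_rank_iff.1 h.ge
  have hrange : Module.rank R φ.range = 1 := by
    have hlift := (LinearEquiv.ofInjective φ hφ).lift_rank_eq
    rwa [Module.rank_self, Cardinal.lift_one, eq_comm, Cardinal.lift_eq_one] at hlift
  have hquot : Module.rank R (M ⧸ φ.range) = 0 := by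
    have hsum := rank_quotient_add_rank_of_isDomain φ.range
    rw [hrange, h] at hsum
    exact Cardinal.eq_of_add_eq_add_right (hsum.trans (zero_add 1).symm) Cardinal.one_lt_aleph0
  have hsum := rank_quotient_add_rank_of_isDomain (φ.restrictScalars A).range
  rw [show Module.rank A (M ⧸ (φ.restrictScalars A).range) = 0 from
    rank_eq_zero_of_isAlgebraic A R (M ⧸ φ.range) hquot, zero_add] at hsum
  rw [Module.finrank, ← hsum]
  exact (LinearEquiv.ofInjective (φ.restrictScalars A) hφ).finrank_eq.symm

end Rank

section MinimalGenerators

variable {R M ι : Type*} [Ring R] [AddCommGroup M] [Module R M] [Finite ι]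

theorem notMem_span_image_compl_singleton {m : ι → M} (hspan : Submodule.span R (Set.range m) = ⊤)
    (hrank : (⊤ : Submodule R M).spanFinrank = Nat.card ι) (i : ι) :
    m i ∉ Submodule.span R (m '' {i}ᶜ) := by
  intro hi
  have htop : Submodule.span R (m '' {i}ᶜ) = ⊤ := by
    rw [eq_top_iff, ← hspan, Submodule.span_le]
    rintro _ ⟨j, rfl⟩
    rcases eq_or_ne j i with rfl | hj
    · exact hi
    · exact Submodule.subset_span (Set.mem_image_of_mem m hj)
  have hle := (Submodule.spanFinrank_span_le_ncard_of_finite (R := R)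
    (Set.toFinite (m '' {i}ᶜ))).trans (Set.ncard_image_le (Set.toFinite _))
  rw [htop, hrank, Set.ncard_compl, Set.ncard_singleton] at hle
  have : 0 < Nat.card ι := Nat.card_pos_iff.2 ⟨⟨i⟩, inferInstance⟩
  omega

end MinimalGenerators

section SMulMatrix

variable {A R M ι : Type*} [CommRing A] [CommRing R] [Algebra A R] [AddCommGroup M] [Module R M]
  [Module A M] [IsScalarTower A R M] [Fintype ι] [DecidableEq ι]

/-- The matrix of the multiplication by a scalar of the `A`-algebra `R`, with respect to an
`A`-basis of an `R`-module. -/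
def smulMatrix (R : Type*) [CommRing R] [Algebra A R] [Module R M] [IsScalarTower A R M]
    (b : Module.Basis ι A M) : R →ₐ[A] Matrix ι ι A :=
  (LinearMap.toMatrixAlgEquiv b).toAlgHom.comp (Algebra.lsmul A A M)

variable (b : Module.Basis ι A M)

theorem smulMatrix_apply (r : R) (i j : ι) : smulMatrix R b r i j = b.repr (r • b j) i :=
  LinearMap.toMatrixAlgEquiv_apply b _ i j

theorem sum_smulMatrix_smul (r : R) (j : ι) : ∑ i, smulMatrix R b r i j • b i = r • b j := by
  simp only [smulMatrix_apply, b.sum_repr]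

theorem pow_smul_mem_span_image {s : Set ι} {r : R}
    (hs : ∀ j ∈ s, ∀ i ∉ s, smulMatrix R b r i j = 0) {j : ι} (hj : j ∈ s) (n : ℕ) :
    r ^ n • b j ∈ Submodule.span A (b '' s) := by
  have hstable : Submodule.span A (b '' s) ≤
      (Submodule.span A (b '' s)).comap (Algebra.lsmul A A M r) := by
    refine Submodule.span_le.2 (Set.image_subset_iff.2 fun l hl => ?_)
    change r • b l ∈ Submodule.span A (b '' s)
    rw [← sum_smulMatrix_smul]
    refine sum_mem fun i _ => ?_
    by_cases hi : i ∈ s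
    · exact Submodule.smul_mem _ _ (Submodule.subset_span (Set.mem_image_of_mem b hi))
    · rw [hs l hl i hi, zero_smul]
      exact zero_mem _
  induction n with
  | zero =>
    rw [pow_zero, one_smul]
    exact Submodule.subset_span (Set.mem_image_of_mem b hj)
  | succ n ih =>
    rw [pow_succ', mul_smul]
    exact hstable ih

theorem not_isUnit_smulMatrix {r : R}
    (hrank : (⊤ : Submodule R M).spanFinrank = Fintype.card ι) {i j : ι} (hij : j ≠ i) :
    ¬ IsUnit (smulMatrix R b r i j) := by
  intro hunit
  have hspan : Submodule.span R (Set.range b) = ⊤ := by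
    rw [eq_top_iff, ← Submodule.restrictScalars_le (S := A), Submodule.restrictScalars_top,
      ← b.span_eq]
    exact Submodule.span_le_restrictScalars A R _
  refine notMem_span_image_compl_singleton hspan (by rwa [Nat.card_eq_fintype_card]) i ?_
  set N := Submodule.span R (b '' {i}ᶜ)
  have hmem (l : ι) (hl : l ≠ i) : b l ∈ N := Submodule.subset_span (Set.mem_image_of_mem b hl)
  have hsum := sum_smulMatrix_smul b r j
  rw [← Finset.add_sum_erase _ _ (Finset.mem_univ i)] at hsum
  refine ((N.restrictScalars A).smul_mem_iff_of_isUnit hunit).1 ?_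
  rw [eq_sub_of_add_eq hsum]
  refine sub_mem (N.smul_mem r (hmem j hij)) (sum_mem fun l hl => ?_)
  exact (N.restrictScalars A).smul_mem _ (hmem l (Finset.ne_of_mem_erase hl))

end SMulMatrix

section Degrees

variable {σ k R M ι : Type*} [Field k] [CommRing R] [Algebra (MvPolynomial σ k) R]
  [AddCommGroup M] [Module R M] [Module (MvPolynomial σ k) M]
  [IsScalarTower (MvPolynomial σ k) R M] {𝓜 : ℤ → AddSubgroup M}

theorem IsPolynomialGraded.repr_eq_intComponent [Finite ι] (h : IsPolynomialGraded σ k 𝓜)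
    (b : Module.Basis ι (MvPolynomial σ k) M) {e : ι → ℤ} (hb : ∀ i, b i ∈ 𝓜 (e i)) {d : ℤ} {x : M}
    (hx : x ∈ 𝓜 d) (i : ι) : b.repr x i = intComponent (d - e i) (b.repr x i) := by
  have := Fintype.ofFinite ι
  have hproj := gradeProj_of_mem h.isInternal hx d
  rw [if_pos rfl] at hproj
  conv_lhs => rw [← hproj, ← b.sum_repr x, map_sum]
  simp only [h.gradeProj_smul _ (hb _), b.repr_sum_self]

variable [Fintype ι] [DecidableEq ι] (h : IsPolynomialGraded σ k 𝓜)
  (b : Module.Basis ι (MvPolynomial σ k) M) {e : ι → ℤ} (hb : ∀ i, b i ∈ 𝓜 (e i)) {r : R}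
  (hr : ∀ d, ∀ m ∈ 𝓜 d, r • m ∈ 𝓜 (1 + d))

include h hb hr

theorem smulMatrix_eq_intComponent (i j : ι) :
    smulMatrix R b r i j = intComponent (1 + e j - e i) (smulMatrix R b r i j) := by
  rw [smulMatrix_apply]
  exact h.repr_eq_intComponent b hb (hr _ _ (hb j)) i

theorem smulMatrix_eq_zero_of_degree_lt
    (hrank : (⊤ : Submodule R M).spanFinrank = Fintype.card ι) {i j : ι} (hij : e j < e i) :
    smulMatrix R b r i j = 0 := by
  have hentry := smulMatrix_eq_intComponent h b hb hr i j
  rcases (show 1 + e j - e i ≤ 0 by omega).lt_or_eq with hneg | hzero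
  · rw [hentry, intComponent_of_neg hneg]
  · rw [hzero, intComponent_zero] at hentry
    by_contra hne
    refine not_isUnit_smulMatrix b (r := r) hrank (ne_of_apply_ne e hij.ne) ?_
    rw [hentry] at hne ⊢
    exact (isUnit_iff_ne_zero.2 fun hc => hne (by rw [hc, C_0])).map C

omit [DecidableEq ι] in
/-- If `e i > e j`, the basis vectors of degree at most `e j` span a proper submodule that is
stable under `r`, hence contains the independent vectors `rⁿ • b j`. -/
theorem degree_le_degree [IsDomain R] [Algebra.IsAlgebraic (MvPolynomial σ k) R]
    (hrank : (⊤ : Submodule R M).spanFinrank = Fintype.card ι)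
    (hpow : LinearIndependent (MvPolynomial σ k) fun n : Fin (Fintype.card ι) => r ^ (n : ℕ))
    (i j : ι) : e i ≤ e j := by
  classical
  have := Module.Basis.isTorsionFree b
  have := isTorsionFree_of_isAlgebraic (MvPolynomial σ k) R M
  let s : Finset ι := {l | e l ≤ e j}
  have hstable : ∀ l ∈ (s : Set ι), ∀ i ∉ (s : Set ι), smulMatrix R b r i l = 0 := by
    intro l hl i hi
    simp only [s, Finset.coe_filter, Finset.mem_univ, true_and, Set.mem_ofPred_eq] at hl hi
    exact smulMatrix_eq_zero_of_degree_lt h b hb hr hrank (by omega)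
  have hmem (n : ℕ) : r ^ n • b j ∈ Submodule.span (MvPolynomial σ k) (b '' s) :=
    pow_smul_mem_span_image b hstable (by simp [s]) n
  have hindep : LinearIndependent (MvPolynomial σ k)
      fun n : Fin (Fintype.card ι) => r ^ (n : ℕ) • b j :=
    hpow.map_injOn ((LinearMap.toSpanSingleton R M (b j)).restrictScalars _)
      (smul_left_injective R (b.ne_zero j)).injOn
  rw [← Finset.coe_image] at hmem
  have hcard := linearIndependent_le_span_aux' _ hindep _ (Set.range_subset_iff.2 fun n => hmem n)
  simp only [Fintype.card_fin, Finset.coe_sort_coe, Fintype.card_coe] at hcard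
  have huniv := Finset.eq_univ_of_card s
    (le_antisymm s.card_le_univ (hcard.trans Finset.card_image_le))
  have hi : i ∈ s := huniv ▸ Finset.mem_univ i
  exact (Finset.mem_filter.1 hi).2

end Degrees

section Pencil

variable {k n : Type*} [CommRing k]

/-- The matrix `y₂ P + y₃ Q` of linear forms. -/
def pencil (P Q : Matrix n n k) : Matrix n n (MvPolynomial (Fin 2) k) :=
  (X 0 : MvPolynomial (Fin 2) k) • P.map C + (X 1 : MvPolynomial (Fin 2) k) • Q.map C

variable [Fintype n] {P Q P' Q' B : Matrix n n k}

theorem semiconjBy_pencil (hP : SemiconjBy B P' P) (hQ : SemiconjBy B Q' Q) :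
    SemiconjBy (B.map (C : k →+* MvPolynomial (Fin 2) k)) (pencil P' Q') (pencil P Q) := by
  simp only [SemiconjBy, pencil, add_mul, mul_add, smul_mul_assoc, mul_smul_comm,
    ← Matrix.map_mul, hP.eq, hQ.eq]

theorem isCubicPair_of_pencil [DecidableEq n]
    (h : pencil P Q ^ 3 = algebraMap (MvPolynomial (Fin 2) k) _ (X 1) *
      (algebraMap (MvPolynomial (Fin 2) k) _ (X 0) ^ 2 - pencil P Q ^ 2)) : IsCubicPair P Q := by
  let ψ : MvPolynomial (Fin 2) k →ₐ[k] Polynomial k := aeval ![1, Polynomial.X]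
  let Ψ : Matrix n n (MvPolynomial (Fin 2) k) →ₐ[k] Polynomial (Matrix n n k) :=
    (matPolyEquiv : _ ≃ₐ[k] _).toAlgHom.comp ψ.mapMatrix
  have hC (P : Matrix n n k) : Ψ (P.map C) = Polynomial.C P := by
    have hmap : (P.map C).map ψ = P.map Polynomial.C := by
      ext : 2
      simp [ψ]
    exact (congrArg matPolyEquiv hmap).trans (matPolyEquiv_map_C P)
  have hsmul (p : MvPolynomial (Fin 2) k) (A : Matrix n n (MvPolynomial (Fin 2) k)) :
      Ψ (p • A) = (ψ p).map (algebraMap k (Matrix n n k)) * Ψ A := by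
    have hmap : (p • A).map ψ = ψ p • A.map ψ := by
      ext : 2
      simp
    exact (congrArg matPolyEquiv hmap).trans (matPolyEquiv_map_smul _ _)
  have hpencil : Ψ (pencil P Q) = Polynomial.C P + Polynomial.X * Polynomial.C Q := by
    simp [pencil, hsmul, hC, ψ]
  have h' := congrArg Ψ h
  simp only [Algebra.algebraMap_eq_smul_one, map_mul, map_sub, map_pow, hsmul, hpencil] at h'
  rw [IsCubicPair, h']
  simp [ψ, mul_sub]

end Pencil

section ChangeOfBasis

variable {A R M ι : Type*} [CommRing A] [CommRing R] [Algebra A R] [AddCommGroup M] [Module R M]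
  [Module A M] [IsScalarTower A R M] [Fintype ι] [DecidableEq ι] (b b' : Module.Basis ι A M)

theorem semiconjBy_smulMatrix (r : R) :
    SemiconjBy (b.toMatrix b') (smulMatrix R b' r) (smulMatrix R b r) :=
  (basis_toMatrix_mul_linearMap_toMatrix b' b b' _).trans
    (linearMap_toMatrix_mul_basis_toMatrix b' b b _).symm

theorem exists_basis_toMatrix_eq {B : Matrix ι ι A} (hB : IsUnit B) :
    ∃ b' : Module.Basis ι A M, b.toMatrix b' = B := by
  refine ⟨b.map (Matrix.toLinearEquiv b B ((Matrix.isUnit_iff_isUnit_det B).1 hB)), ?_⟩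
  ext i j
  rw [Module.Basis.toMatrix_apply, Module.Basis.map_apply, Matrix.toLinearEquiv_apply,
    ← LinearMap.toMatrix_apply, LinearMap.toMatrix_toLin]

end ChangeOfBasis

section LinearForms

variable {k R M ι : Type*} [Field k] [CommRing R] [Algebra (MvPolynomial (Fin 2) k) R]
  [AddCommGroup M] [Module R M] [Module (MvPolynomial (Fin 2) k) M]
  [IsScalarTower (MvPolynomial (Fin 2) k) R M] {𝓜 : ℤ → AddSubgroup M} [Fintype ι] [DecidableEq ι]

theorem exists_intComponent_one_eq (a : MvPolynomial (Fin 2) k) :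
    ∃ p q : k, intComponent 1 a = X 0 * C p + X 1 * C q := by
  have hmem : intComponent 1 a ∈ homogeneousSubmodule (Fin 2) k 1 := by
    have hcomponent := homogeneousComponent_isHomogeneous 1 a
    rwa [← intComponent_natCast, Nat.cast_one] at hcomponent
  rw [homogeneousSubmodule_one_eq_span_X, Submodule.mem_span_range_iff_exists_fun] at hmem
  obtain ⟨c, hc⟩ := hmem
  refine ⟨c 0, c 1, ?_⟩
  rw [← hc, Fin.sum_univ_two, smul_eq_C_mul, smul_eq_C_mul, mul_comm, mul_comm (X 1)]

variable (h : IsPolynomialGraded (Fin 2) k 𝓜) (b : Module.Basis ι (MvPolynomial (Fin 2) k) M)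
  {e : ℤ} (hb : ∀ i, b i ∈ 𝓜 e)

include h hb

theorem exists_smulMatrix_eq_pencil {r : R} (hr : ∀ d, ∀ m ∈ 𝓜 d, r • m ∈ 𝓜 (1 + d)) :
    ∃ P Q : Matrix ι ι k, smulMatrix R b r = pencil P Q := by
  choose P Q hPQ using fun i j => exists_intComponent_one_eq (smulMatrix R b r i j)
  refine ⟨Matrix.of P, Matrix.of Q, Matrix.ext fun i j => ?_⟩
  rw [smulMatrix_eq_intComponent h b hb hr, add_sub_cancel_right, hPQ]
  rfl

theorem exists_basis_smulMatrix_eq_pencil {r : R} {P Q P' Q' B : Matrix ι ι k}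
    (hr : smulMatrix R b r = pencil P Q) (hB : IsUnit B) (hP : SemiconjBy B P' P)
    (hQ : SemiconjBy B Q' Q) : ∃ b' : Module.Basis ι (MvPolynomial (Fin 2) k) M,
      (∀ i, b' i ∈ 𝓜 e) ∧ smulMatrix R b' r = pencil P' Q' := by
  have hBC : IsUnit (B.map (C : k →+* MvPolynomial (Fin 2) k)) := hB.map C.mapMatrix
  obtain ⟨b', hb'⟩ := exists_basis_toMatrix_eq b hBC
  refine ⟨b', fun j => ?_, hBC.mul_left_cancel ?_⟩
  · rw [← b.sum_toMatrix_smul_self b' j, hb']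
    refine sum_mem fun i _ => ?_
    simpa using h.smul_mem (isHomogeneous_C (Fin 2) (B i j)) (hb i)
  · rw [(semiconjBy_pencil hP hQ).eq, ← hr, ← hb', (semiconjBy_smulMatrix b b' r).eq]

end LinearForms

section CokerLift

variable {k : Type u} [Field k] {M : Type v} [AddCommGroup M] [Module (NodeRing k) M]
  {A : Matrix (Fin 3) (Fin 3) (MvPolynomial (Fin 3) k)} {g : Fin 3 → M}

/-- The map out of a cokernel determined by elements that satisfy the relations given by the columns
of the matrix. -/
def cokerLift (hrel : ∀ j, ∑ i, quot k (A i j) • g i = 0) : Coker A →ₗ[NodeRing k] M :=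
  Submodule.liftQ _ (Fintype.linearCombination (NodeRing k) g) <| by
    rw [Matrix.range_mulVecLin, Submodule.span_le]
    rintro _ ⟨j, rfl⟩
    exact hrel j

theorem cokerLift_surjective (hrel : ∀ j, ∑ i, quot k (A i j) • g i = 0)
    (hspan : Submodule.span (NodeRing k) (Set.range g) = ⊤) :
    Function.Surjective (cokerLift hrel) := by
  rw [← LinearMap.range_eq_top, cokerLift, Submodule.range_liftQ, Fintype.range_linearCombination,
    hspan]

theorem cokerLift_mem (hrel : ∀ j, ∑ i, quot k (A i j) • g i = 0) {𝓜 : ℤ → AddSubgroup M}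
    (h : IsGraded (k := k) 𝓜) {e : ℤ} (hg : ∀ i, g i ∈ 𝓜 e) (j : ℤ) (x : Coker A)
    (hx : x ∈ cokerDeg A j) : cokerLift hrel x ∈ 𝓜 (j + (e - 1)) := by
  obtain ⟨z, hz, rfl⟩ := hx
  change ∑ i, z i • g i ∈ _
  refine sum_mem fun i _ => ?_
  convert h.2 _ _ _ _ (hz i trivial) (hg i) using 2
  ring

theorem injective_of_surjective_of_rank_eq_one {R M N : Type*} [CommRing R] [IsDomain R]
    [AddCommGroup M] [Module R M] [AddCommGroup N] [Module R N] [Module.IsTorsionFree R N]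
    {φ : N →ₗ[R] M} (hφ : Function.Surjective φ) (hN : Module.rank R N = 1)
    (hM : Module.rank R M = 1) : Function.Injective φ := by
  have hrank := LinearMap.lift_rank_range_add_rank_ker φ
  rw [LinearMap.range_eq_top.2 hφ, rank_top, hM, hN, Cardinal.lift_one, Cardinal.lift_one] at hrank
  have hker := Cardinal.eq_of_add_eq_add_left (hrank.trans (add_zero 1).symm)
    Cardinal.one_lt_aleph0
  rwa [Cardinal.lift_eq_zero, rank_zero_iff, Submodule.subsingleton_iff_eq_bot,
    LinearMap.ker_eq_bot] at hker

theorem isoUpToShift_of_relations {𝓜 : ℤ → AddSubgroup M} (h : IsGraded (k := k) 𝓜)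
    (hrank : Module.rank (NodeRing k) M = 1) {a b : k} (hab : b ^ 2 = a ^ 3 + a ^ 2) {e : ℤ}
    (hg : ∀ i, g i ∈ 𝓜 e) (hspan : Submodule.span (NodeRing k) (Set.range g) = ⊤)
    (hrel : ∀ j, ∑ i, quot k (alpha a b i j) • g i = 0) :
    IsoUpToShift (k := k) 𝓜 (cokerDeg (alpha a b)) := by
  have : Module.IsTorsionFree (NodeRing k) (Coker (alpha a b)) :=
    (cokerToRing_injective hab).moduleIsTorsionFree _ (map_smul _)
  have hsurj := cokerLift_surjective hrel hspan
  have hinj := injective_of_surjective_of_rank_eq_one hsurj (rank_coker_alpha hab) hrank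
  let E := LinearEquiv.ofBijective (cokerLift hrel) ⟨hinj, hsurj⟩
  refine ⟨1 - e, E.symm, fun j x => ?_⟩
  obtain ⟨y, rfl⟩ := E.surjective x
  have hiff := mem_iff_map_mem (isGraded_cokerDeg (isHomogeneous_alpha a b)).1 h.1
    (add_left_injective (e - 1)) (φ := (cokerLift hrel).toAddMonoidHom) hinj
    (cokerLift_mem hrel h hg) (j + (1 - e)) y
  rw [show j + (1 - e) + (e - 1) = j by ring] at hiff
  rw [E.symm_apply_apply]
  exact hiff.symm

end CokerLift

section Classification

variable {k : Type u} [Field k] {M : Type v} [AddCommGroup M] [Module (NodeRing k) M]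
  {𝓜 : ℤ → AddSubgroup M}

theorem IsGraded.quot_X_smul_mem (h : IsGraded (k := k) 𝓜) (i : Fin 3) (d : ℤ) :
    ∀ m ∈ 𝓜 d, quot k (X i) • m ∈ 𝓜 (1 + d) :=
  fun m hm => h.2 1 d _ m (quot_mem_ringDeg (isHomogeneous_X k i)) hm

variable [Module (MvPolynomial (Fin 2) k) M] [IsScalarTower (MvPolynomial (Fin 2) k) (NodeRing k) M]

theorem isCubicPair_of_smulMatrix_eq_pencil {ι : Type*} [Fintype ι] [DecidableEq ι]
    {m : Module.Basis ι (MvPolynomial (Fin 2) k) M} {P Q : Matrix ι ι k}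
    (hm : smulMatrix (NodeRing k) m (quot k (X 0)) = pencil P Q) : IsCubicPair P Q := by
  have hcubic := congrArg (smulMatrix (NodeRing k) m) (quot_X_zero_pow_three k)
  have hX₁ : quot k (X 1) = algebraMap _ _ (X 0 : MvPolynomial (Fin 2) k) := by
    rw [algebraMap_eq, rename_X, Fin.succ_zero_eq_one]
  have hX₂ : quot k (X 2) = algebraMap _ _ (X 1 : MvPolynomial (Fin 2) k) := by
    rw [algebraMap_eq, rename_X, Fin.succ_one_eq_two]
  refine isCubicPair_of_pencil ?_
  rwa [map_pow, map_mul, map_sub (quot k), map_pow, map_pow, map_sub, map_pow, map_pow, hm, hX₁,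
    hX₂, AlgHom.commutes, AlgHom.commutes] at hcubic

theorem IsGradedMCM.exists_homogeneous_basis (hM : IsGradedMCM (k := k) 𝓜) :
    ∃ (n : ℕ) (m : Module.Basis (Fin n) (MvPolynomial (Fin 2) k) M) (e : Fin n → ℤ),
      ∀ i, m i ∈ 𝓜 (e i) := by
  obtain ⟨hfin, h, rs, hrs, hlen, hreg⟩ := hM
  rw [ringKrullDim_nodeRing] at hlen
  obtain ⟨r, s, rfl⟩ := List.length_eq_two.1 (by exact_mod_cast hlen)
  have : Module.Finite (MvPolynomial (Fin 2) k) M := .trans (NodeRing k) M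
  have hregX := h.isWeaklyRegular_of_isWeaklyRegular h.isPolynomialGraded.exists_forall_lt_eq_bot
    (hrs r (by simp)) (hrs s (by simp)) hreg.toIsWeaklyRegular
  refine h.isPolynomialGraded.exists_homogeneous_basis ?_
  rw [← RingTheory.Sequence.isWeaklyRegular_map_algebraMap_iff (NodeRing k)]
  simpa only [List.map_cons, List.map_nil, algebraMap_eq, rename_X, Fin.succ_zero_eq_one,
    Fin.succ_one_eq_two] using hregX

theorem IsGradedMCM.exists_basis_of_rank_eq_one (hM : IsGradedMCM (k := k) 𝓜)
    (hmin : IsMinimallyGenerated k M 3) (hrank : Module.rank (NodeRing k) M = 1) :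
    ∃ (m : Module.Basis (Fin 3) (MvPolynomial (Fin 2) k) M) (e : ℤ), ∀ i, m i ∈ 𝓜 e := by
  obtain ⟨n, m, e, hm⟩ := hM.exists_homogeneous_basis
  obtain rfl : n = 3 := by
    rw [← finrank_nodeRing k, ← finrank_eq_finrank_of_rank_eq_one _ _ M hrank,
      Module.finrank_eq_card_basis m, Fintype.card_fin]
  have hspan : (⊤ : Submodule (NodeRing k) M).spanFinrank = Fintype.card (Fin 3) := by
    rw [Submodule.spanFinrank, hmin, Cardinal.toNat_natCast, Fintype.card_fin]
  have hle := degree_le_degree hM.2.1.isPolynomialGraded m hm (hM.2.1.quot_X_smul_mem 0) hspan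
    (linearIndependent_pow k)
  exact ⟨m, e 0, fun i => le_antisymm (hle i 0) (hle 0 i) ▸ hm i⟩

theorem IsGradedMCM.exists_basis_normalForm (hM : IsGradedMCM (k := k) 𝓜)
    (hmin : IsMinimallyGenerated k M 3) (hrank : Module.rank (NodeRing k) M = 1) :
    ∃ (m : Module.Basis (Fin 3) (MvPolynomial (Fin 2) k) M) (e : ℤ) (a b : k),
      (∀ i, m i ∈ 𝓜 e) ∧ b ^ 2 = a ^ 3 + a ^ 2 ∧
        smulMatrix (NodeRing k) m (quot k (X 0)) = pencil (jordan k) (normalForm a b) := by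
  obtain ⟨m, e, hm⟩ := hM.exists_basis_of_rank_eq_one hmin hrank
  have hgraded := hM.2.1.isPolynomialGraded
  obtain ⟨P, Q, hPQ⟩ := exists_smulMatrix_eq_pencil hgraded m hm (hM.2.1.quot_X_smul_mem 0)
  obtain ⟨B, a, b, hB, hP, hQ, hab⟩ :=
    (isCubicPair_of_smulMatrix_eq_pencil hPQ).exists_normalForm
  obtain ⟨m', hm', hm'PQ⟩ := exists_basis_smulMatrix_eq_pencil hgraded m hm hPQ hB hP hQ
  exact ⟨m', e, a, b, hm', hab, hm'PQ⟩

/-- The relations `y₁ mⱼ = ∑ (y₂ P + y₃ Q)ᵢⱼ mᵢ` for a basis in normal form are, up to sign and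
order of the generators, the columns of `α`. -/
theorem sum_quot_alpha_smul_eq_zero {m : Module.Basis (Fin 3) (MvPolynomial (Fin 2) k) M}
    {a b : k}
    (hm : smulMatrix (NodeRing k) m (quot k (X 0)) = pencil (jordan k) (normalForm a b))
    (j : Fin 3) : ∑ i, quot k (alpha a b i j) • (![-m 1, m 0, -m 2] : Fin 3 → M) i = 0 := by
  have hrel (j : Fin 3) :
      ∑ i, quot k (rename Fin.succ (pencil (jordan k) (normalForm a b) i j)) • m i =
        quot k (X 0) • m j := by
    simp only [← algebraMap_eq, algebraMap_smul, ← hm]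
    exact sum_smulMatrix_smul m _ j
  simp only [Fin.sum_univ_three, pencil, Matrix.add_apply, Matrix.smul_apply, Matrix.map_apply,
    smul_eq_mul, map_add, map_mul, rename_X, rename_C, Fin.succ_zero_eq_one,
    Fin.succ_one_eq_two] at hrel
  have h0 := hrel 0
  have h1 := hrel 1
  have h2 := hrel 2
  simp only [jordan, normalForm, Matrix.of_apply, Matrix.cons_val', Matrix.cons_val_zero,
    Matrix.cons_val_one, Matrix.cons_val, map_add, map_sub, map_neg, map_pow, map_zero,
    map_one] at h0 h1 h2
  fin_cases j <;>
    simp only [Fin.sum_univ_three, alpha, Matrix.of_apply, Matrix.cons_val', Matrix.cons_val_zero,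
      Matrix.cons_val_one, Matrix.cons_val, map_add, map_sub, map_mul, map_neg, map_pow, map_zero,
      map_one, Fin.zero_eta, Fin.mk_one, Fin.reduceFinMk]
  · linear_combination (norm := module) -h0
  · linear_combination (norm := module) h1
  · linear_combination (norm := module) -h2

end Classification

section IsoUpToShift

variable {k : Type u} [Field k] {M : Type v} [AddCommGroup M] [Module (NodeRing k) M]
  {𝓜 : ℤ → AddSubgroup M}

theorem IsGradedMCM.exists_isoUpToShift (hM : IsGradedMCM (k := k) 𝓜)
    (hmin : IsMinimallyGenerated k M 3) (hrank : Module.rank (NodeRing k) M = 1) :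
    ∃ a b : k, b ^ 2 = a ^ 3 + a ^ 2 ∧ IsoUpToShift (k := k) 𝓜 (cokerDeg (alpha a b)) := by
  let _ : Module (MvPolynomial (Fin 2) k) M := Module.compHom M (algebraMap _ (NodeRing k))
  have : IsScalarTower (MvPolynomial (Fin 2) k) (NodeRing k) M :=
    .of_algebraMap_smul fun _ _ => rfl
  obtain ⟨m, e, a, b, hm, hab, hmPQ⟩ := hM.exists_basis_normalForm hmin hrank
  let g : Fin 3 → M := ![-m 1, m 0, -m 2]
  have hspan (i : Fin 3) : m i ∈ Submodule.span (NodeRing k) (Set.range g) := by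
    have hg (i : Fin 3) := Submodule.subset_span (R := NodeRing k) (Set.mem_range_self (f := g) i)
    fin_cases i
    · exact hg 1
    · exact (Submodule.neg_mem_iff _).1 (hg 0)
    · exact (Submodule.neg_mem_iff _).1 (hg 2)
  refine ⟨a, b, hab, isoUpToShift_of_relations hM.2.1 hrank hab (e := e) (g := g) ?_ ?_
    (sum_quot_alpha_smul_eq_zero hmPQ)⟩
  · rw [Fin.forall_fin_succ, Fin.forall_fin_two]
    exact ⟨neg_mem (hm 1), hm 0, neg_mem (hm 2)⟩
  · refine Submodule.restrictScalars_injective (MvPolynomial (Fin 2) k) _ _ (top_le_iff.1 ?_)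
    rw [← m.span_eq, Submodule.span_le]
    rintro _ ⟨i, rfl⟩
    exact hspan i

end IsoUpToShift

end NodalCone

end

theorem mainTheorem6_general (k : Type*) [Field k] :
    (∀ a b : k, pt a b ∈ curve k →
      IsMatrixFactorization (cubic k) (alpha a b) (beta a b)) ∧
    (∀ a b : k, pt a b ∈ curve k →
      IsGradedMCM (k := k) (cokerDeg (alpha a b)) ∧
      IsMinimallyGenerated k (Coker (alpha a b)) 3 ∧
      Module.rank (NodeRing k) (Coker (alpha a b)) = 1) ∧
    (∀ a b c d : k, pt a b ≠ pt c d →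
      IsEmpty (Coker (alpha a b) ≃ₗ[NodeRing k] Coker (alpha c d))) ∧
    (∀ (M : Type*) [AddCommGroup M] [Module (NodeRing k) M] (𝓜 : ℤ → AddSubgroup M),
      IsGradedMCM (k := k) 𝓜 → IsMinimallyGenerated k M 3 →
      Module.rank (NodeRing k) M = 1 →
      (∃ a b : k, pt a b ∈ regularLocus k \ {pt₀ k} ∧
        IsoUpToShift (k := k) 𝓜 (cokerDeg (alpha a b))) ∨
      IsoUpToShift (k := k) 𝓜 (cokerDeg (alpha (0 : k) 0))) := by
  refine ⟨fun a b h => isMatrixFactorization_alpha (pt_mem_curve_iff.1 h), fun a b h => ?_,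
    fun a b c d hne => ⟨fun e => hne ?_⟩, fun M _ _ 𝓜 hM hmin hrank => ?_⟩
  · have hab := pt_mem_curve_iff.1 h
    exact ⟨isGradedMCM_coker_alpha hab, isMinimallyGenerated_coker (isHomogeneous_alpha a b),
      rank_coker_alpha hab⟩
  · obtain ⟨rfl, rfl⟩ := alpha_parameters_eq_of_equiv e
    rfl
  · obtain ⟨a, b, hab, hiso⟩ := hM.exists_isoUpToShift hmin hrank
    by_cases h0 : a = 0 ∧ b = 0
    · obtain ⟨rfl, rfl⟩ := h0
      exact Or.inr hiso
    · exact Or.inl ⟨a, b, pt_mem_regularLocus hab h0, hiso⟩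

theorem mainTheorem6 (k : Type*) [Field k] :
    (∀ a b : k, pt a b ∈ curve k →
      IsMatrixFactorization (cubic k) (alpha a b) (beta a b)) ∧
    (∀ a b : k, pt a b ∈ regularLocus k \ {pt₀ k} →
      IsGradedMCM (k := k) (cokerDeg (alpha a b)) ∧
      IsMinimallyGenerated k (Coker (alpha a b)) 3 ∧
      Module.rank (NodeRing k) (Coker (alpha a b)) = 1) ∧
    (∀ a b c d : k, pt a b ∈ regularLocus k \ {pt₀ k} → pt c d ∈ regularLocus k \ {pt₀ k} →
      pt a b ≠ pt c d →
      IsEmpty (Coker (alpha a b) ≃ₗ[NodeRing k] Coker (alpha c d))) ∧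
    (∀ (M : Type*) [AddCommGroup M] [Module (NodeRing k) M] (𝓜 : ℤ → AddSubgroup M),
      IsGradedMCM (k := k) 𝓜 → IsMinimallyGenerated k M 3 →
      Module.rank (NodeRing k) M = 1 →
      (∃ a b : k, pt a b ∈ regularLocus k \ {pt₀ k} ∧
        IsoUpToShift (k := k) 𝓜 (cokerDeg (alpha a b))) ∨
      IsoUpToShift (k := k) 𝓜 (cokerDeg (alpha (0 : k) 0))) :=
  let ⟨h₁, h₂, h₃, h₄⟩ := mainTheorem6_general k
  ⟨h₁, fun a b h => h₂ a b h.1.1, fun a b c d _ _ => h₃ a b c d, h₄⟩
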